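/- Let $p\ge 2$ be an integer, $\alpha_0=\sqrt{2p}-\sqrt{2/p}$ and $c=1-3\alpha_0^2$. For $\lambda\in\mathbb C$ let $\mathcal F_\lambda$ be the rank-one Heisenberg Fock module of highest weight $\lambda$, with the Virasoro action given by the conformal vector $\frac12(a_{-1}^2+\alpha_0a_{-2})\mathbf 1$, so that its highest weight vector has conformal dimension $\frac12\lambda(\lambda-\alpha_0)$. Put $\mathrm{ch}[\mathcal F_\lambda](\tau)=\mathrm{tr}_{\mathcal F_\lambda}q^{L(0)-c/24}$, $q=e^{2\pi i\tau}$, $\operatorname{Im}\tau>0$, and for $\epsilon\in\mathbb C$ define the regularised character $\mathrm{ch}[\mathcal F^\epsilon_\lambda](\tau)=e^{2\pi\epsilon(\lambda-\alpha_0/2)}\,\mathrm{ch}[\mathcal F_\lambda](\tau)$. For $s,n\in\mathbb Z$ let $\mathcal F_{1,s;n}=\mathcal F_\lambda$ with $\lambda=-\frac{1-s}{2}\sqrt{2/p}+\frac n2\sqrt{2p}$. For $r\in\mathbb Z$ and $1\le s\le p$, the regularised character of the irreducible atypical module $M_{r,s}$ of the singlet algebra $\mathcal M(p)=M_{1,1}$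 is, by definition, $$\mathrm{ch}[M_{r,s}^\epsilon]=\sum_{j\ge0}\Big(\mathrm{ch}[\mathcal F^\epsilon_{1,s;r-1-2j}]-\mathrm{ch}[\mathcal F^\epsilon_{1,p-s;r-2-2j}]\Big)\ \ (s<p),\qquad \mathrm{ch}[M_{r,p}^\epsilon]=\mathrm{ch}[\mathcal F^\epsilon_{1,p;r-1}],$$ and its regularised quantum dimension is $$\mathrm{qdim}[M_{r,s}^\epsilon]=\lim_{y\to0+}\frac{\mathrm{ch}[M_{r,s}^\epsilon](iy)}{\mathrm{ch}[M_{1,1}^\epsilon](iy)}$$ whenever the denominator is nonzero for all sufficiently small $y>0$ and the limit exists. Let $$B_\epsilon^p=-\min\Big\{\Big|\tfrac{m}{\sqrt{2p}}-\operatorname{Im}\epsilon\Big|\ :\ m\in\mathbb Z\setminus p\mathbb Z\Big\},$$ and for $k\in\mathbb Z$, $0\le m\le 2p-1$, let $$\mathbb S_{k,m}=\Big\{\epsilon\in\mathbb C:\ k+\tfrac{2m-1}{4p}<\tfrac{\operatorname{Im}\epsilon}{\sqrt{2p}}<k+\tfrac{2m+1}{4p}\Big\},\qquad n=2pk+m.$$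 Let $r\in\mathbb Z$, $1\le s\le p$, $k\in\mathbb Z$ and $0\le m\le 2p-1$. 1. If $m\ne0,p$, then for every $\epsilon\in\mathbb S_{k,m}$ with $\operatorname{Re}\epsilon<B^p_\epsilon$ the quantum dimension exists and $$\mathrm{qdim}[M_{r,s}^\epsilon]=(-1)^{m(r-1)}\frac{\sin(\pi ms/p)}{\sin(\pi m/p)}.$$ 2. If $m=0$ or $m=p$, then for every $\epsilon\in\mathbb S_{k,m}$ with $\operatorname{Re}\epsilon<B^p_\epsilon$ and $\operatorname{Im}\epsilon\neq\frac{n}{\sqrt{2p}}$ the quantum dimension exists and $$\mathrm{qdim}[M_{r,s}^\epsilon]=(-1)^{(m+1)(r-1)+\frac mp(s-1)}\frac{\sin(\pi s/p)}{\sin(\pi/p)}.$$ On the centre line $\operatorname{Im}\epsilon=\frac{n}{\sqrt{2p}}$ of such a strip, with $\operatorname{Re}\epsilon<B_\epsilon^p$, the quotient $\mathrm{ch}[M_{r,s}^\epsilon](iy)/\mathrm{ch}[M_{1,1}^\epsilon](iy)$ has (eventually) nonzero denominator and tends to the same value when, for an arbitrary fixed $\delta>0$, $y\to0+$ through those $y$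 with $\left|\sin\frac{2\pi\operatorname{Re}\epsilon}{\sqrt{2p}\,y}\right|\ge\delta$. 3. If $m\ne0,p$, then the quantum dimension exists at every point $\epsilon\ne\frac{in}{\sqrt{2p}}$ of the horizontal line through the drip point $\frac{in}{\sqrt{2p}}$, and its limits along this line from the right ($\operatorname{Re}\epsilon\to0+$, the continuous regime) and from the left ($\operatorname{Re}\epsilon\to0-$) agree with the value in 1: $$\lim_{\epsilon\to(in/\sqrt{2p})^{+}}\mathrm{qdim}[M_{r,s}^\epsilon]=(-1)^{m(r-1)}\frac{\sin(\pi ms/p)}{\sin(\pi m/p)}=\lim_{\epsilon\to(in/\sqrt{2p})^{-}}\mathrm{qdim}[M_{r,s}^\epsilon].$$ -/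

import Mathlib

open Filter Topology

namespace Singlet

noncomputable section

/-- The background charge `α₀ = α₊ + α₋` with `α₊ = √(2p)` and `α₋ = -√(2/p)`. -/
def alphaZero (p : ℕ) : ℝ := √(2 * p) - √(2 / p)

/-- The central charge `c = 1 - 3 α₀²`. -/
def centralCharge (p : ℕ) : ℝ := 1 - 3 * alphaZero p ^ 2

/-- The Heisenberg weight
`α_{r,s;n} = (1 - r)/2 · α₊ + (1 - s)/2 · α₋ + n/2 · √(2p)` (for `p₊ = 1`, `p₋ = p`). -/
def fockWeight (p : ℕ) (r s n : ℤ) : ℝ :=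
  (1 - r) / 2 * √(2 * p) + (1 - s) / 2 * (-√(2 / p)) + n / 2 * √(2 * p)

/-- The space of the Fock module `F_wt`, realised as polynomials in `x₁, x₂, …`. The Heisenberg
algebra acts through `a₋ₙ = (multiplication by xₙ)` and `aₙ = n ∂/∂xₙ` for `n ≥ 1`, while `a₀`
acts as the scalar `wt`; the highest weight vector is the constant polynomial `1`. -/
abbrev Fock : Type := MvPolynomial ℕ+ ℂ

/-- The conformal dimension `Δ = wt (wt - α₀) / 2` of the highest weight vector of `F_wt`. -/
def confDim (p : ℕ) (wt : ℂ) : ℂ := wt * (wt - alphaZero p) / 2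

/-- The Virasoro zero mode for the conformal vector `ω = ½ (a₋₁² + α₀ a₋₂) 1`, that is
`L(0) = ½ (a₀² - α₀ a₀) + ∑_{n ≥ 1} a₋ₙ aₙ`, acting on `F_wt`. The last sum is
`∑ₙ n xₙ ∂/∂xₙ`, the derivation that maps `xₙ` to `n xₙ`. -/
def fockL0 (p : ℕ) (wt : ℂ) : Module.End ℂ Fock :=
  confDim p wt • LinearMap.id +
    ((MvPolynomial.mkDerivation ℂ (fun n : ℕ+ => ((n : ℕ) : ℂ) • (MvPolynomial.X n : Fock)) :
      Derivation ℂ Fock Fock) : Fock →ₗ[ℂ] Fock)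

/-- The character `ch[F_wt](τ) = tr q^{L(0) - c/24}`, `q = e^{2πiτ}`: the eigenvalues of `L(0)`
are `Δ + d` with `d = 0, 1, 2, …`, and each is weighted by the dimension of its eigenspace. -/
def fockChar (p : ℕ) (wt τ : ℂ) : ℂ :=
  ∑' d : ℕ, (Module.finrank ℂ ((fockL0 p wt).eigenspace (confDim p wt + d)) : ℂ) *
    Complex.exp (2 * Real.pi * Complex.I * τ * (confDim p wt + d - centralCharge p / 24))

/-- The regularised character `ch[F_wt^ε](τ) = e^{2πε(wt - α₀/2)} ch[F_wt](τ)`. -/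
def regFockChar (p : ℕ) (ε wt τ : ℂ) : ℂ :=
  Complex.exp (2 * Real.pi * ε * (wt - alphaZero p / 2)) * fockChar p wt τ

/-- The regularised character of the atypical singlet module `M_{r,s} ≅ I_{1,s;r-1}`. For
`1 ≤ s < p` it is the alternating sum of the regularised characters along the Felder
co-resolution
`0 → M_{r,s} → F_{1,s;r-1} → F_{1,p-s;r-2} → F_{1,s;r-3} → F_{1,p-s;r-4} → ⋯`,
and `M_{r,p}` is the Fock module `F_{1,p;r-1}`. -/
def regChar (p : ℕ) (r : ℤ) (s : ℕ) (ε τ : ℂ) : ℂ :=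
  if s = p then regFockChar p ε (fockWeight p 1 p (r - 1)) τ
  else ∑' j : ℕ,
    (regFockChar p ε (fockWeight p 1 s (r - 1 - 2 * j)) τ -
      regFockChar p ε (fockWeight p 1 (p - s) (r - 1 - 2 * j - 1)) τ)

/-- The quotient `ch[M_{r,s}^ε](iy) / ch[M_{1,1}^ε](iy)`; the singlet algebra itself is
`M_{1,1}`. -/
def charRatio (p : ℕ) (r : ℤ) (s : ℕ) (ε : ℂ) (y : ℝ) : ℂ :=
  regChar p r s ε (Complex.I * y) / regChar p 1 1 ε (Complex.I * y)

/-- Along the filter `l` the quotient of regularised characters is eventually defined (its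
denominator does not vanish) and converges to `d`. -/
def HasQDimAlong (l : Filter ℝ) (p : ℕ) (r : ℤ) (s : ℕ) (ε d : ℂ) : Prop :=
  (∀ᶠ y : ℝ in l, regChar p 1 1 ε (Complex.I * y) ≠ 0) ∧ Tendsto (charRatio p r s ε) l (𝓝 d)

/-- The regularised quantum dimension `qdim[M_{r,s}^ε] = lim_{y → 0+} ch[M_{r,s}^ε](iy) /
ch[M_{1,1}^ε](iy)` exists and equals `d`. -/
def HasQDim (p : ℕ) (r : ℤ) (s : ℕ) (ε d : ℂ) : Prop :=
  HasQDimAlong (𝓝[>] 0) p r s ε d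

/-- The regularised quantum dimension as a function of `ε` (meaningful where it exists). -/
def qdim (p : ℕ) (r : ℤ) (s : ℕ) (ε : ℂ) : ℂ :=
  limUnder (𝓝[>] (0 : ℝ)) (charRatio p r s ε)

/-- The wall `B_ε^p = - min { |m/√(2p) - Im ε| : m ∈ ℤ \ pℤ }`. -/
def wall (p : ℕ) (ε : ℂ) : ℝ :=
  - sInf {x : ℝ | ∃ m : ℤ, ¬ (p : ℤ) ∣ m ∧ x = |m / √(2 * p) - ε.im|}

/-- The open strip `S_{k,m}`. -/
def strip (p : ℕ) (k : ℤ) (m : ℕ) : Set ℂ :=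
  {ε : ℂ | k + (2 * (m : ℝ) - 1) / (4 * p) < ε.im / √(2 * p) ∧
    ε.im / √(2 * p) < k + (2 * (m : ℝ) + 1) / (4 * p)}

/-- The value `(-1)^{m(r-1)} sin(πms/p) / sin(πm/p)`, for `m ≠ 0, p`. -/
def genericValue (p : ℕ) (r : ℤ) (s m : ℕ) : ℂ :=
  (-1) ^ ((m : ℤ) * (r - 1)) *
    ((Real.sin (Real.pi * m * s / p) / Real.sin (Real.pi * m / p) : ℝ) : ℂ)

/-- The value `(-1)^{(m+1)(r-1) + (m/p)(s-1)} sin(πs/p) / sin(π/p)`, for `m = 0, p` (where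
`m / p` is an exact quotient). -/
def exceptionalValue (p : ℕ) (r : ℤ) (s m : ℕ) : ℂ :=
  (-1) ^ (((m : ℤ) + 1) * (r - 1) + ((m / p : ℕ) : ℤ) * ((s : ℤ) - 1)) *
    ((Real.sin (Real.pi * s / p) / Real.sin (Real.pi / p) : ℝ) : ℂ)

/-- The point with real part `t` on the horizontal line through the drip point `i n / √(2p)`,
`n = 2pk + m`; this line is also the centre line of the strip `S_{k,m}`. -/
def centrePoint (p : ℕ) (k : ℤ) (m : ℕ) (t : ℝ) : ℂ :=
  ⟨t, (2 * p * k + m) / √(2 * p)⟩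

end

end Singlet

/-! At `τ = iy` every Fock character is a Gaussian in `λ - α₀/2` times `1/η(iy)`, and this common
factor is nonzero and cancels in the quotient. Since `λ - α₀/2 = N/√(2p)` with `N` an integer, the
character of `M_{r,s}` with `s < p` becomes one half of a difference of two theta series over
classes modulo `2p`.

For `Re ε < 0` the missing half converges absolutely even at `y = 0`, hence stays bounded as `y →
0+` (`exists_norm_complementSum_le`). The full series is Poisson summed (`tsum_fockTerm`) into
Gaussians of modulus `exp(π((Re ε)² - (Im ε - n/√(2p))²)/y)`. Their coefficients are a sign times
`2i sin(πns/p)` and vanish for `p ∣ n`. So the nearest `n` outside `pℤ` dominates, and `Re ε < B`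
says exactly that its Gaussian blows up and beats the bounded part. The quantum dimension is then
the ratio of the two leading coefficients (`hasQDimAlong_of_dominant`).

In a strip with `m ≠ 0, p` the nearest index is `n = 2pk + m`. If `m = 0` or `m = p`, that index is
invisible and a neighbour `n ± 1` takes over; the coefficients at the two neighbours are opposite,
so both sides give the same ratio. On the centre line the neighbours tie and combine to a multiple
of `sin θ(y)`, common to numerator and denominator; it only has to be kept away from zero.

For `Re ε > 0` the limit passes inside the defining sum, which becomes geometric and gives a
quotient of hyperbolic sines. At a drip point with `p ∤ m` this is continuous, and `sinh(ix) = i sin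
x` turns it into the value found on the left. -/

namespace Singlet

/-! ### Fock module characters and the oscillator factor -/

/-- The conformal weight `∑ₙ n sₙ` of the monomial with exponents `s`. -/
def monomialWeight (s : ℕ+ →₀ ℕ) : ℕ := s.sum fun n k => k * n

/-- The number of monomials of a given conformal weight. -/
noncomputable def levelDim (d : ℕ) : ℕ := Nat.card {s : ℕ+ →₀ ℕ // monomialWeight s = d}

theorem coeff_weightDerivation (φ : Fock) (s : ℕ+ →₀ ℕ) :
    MvPolynomial.coeff s ((MvPolynomial.mkDerivation ℂ
      (fun n : ℕ+ => ((n : ℕ) : ℂ) • (MvPolynomial.X n : Fock)) : Derivation ℂ Fock Fock) φ) =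
    monomialWeight s * MvPolynomial.coeff s φ := by
  induction φ using MvPolynomial.induction_on' with
  | add p q hp hq => rw [map_add, MvPolynomial.coeff_add, hp, hq, MvPolynomial.coeff_add, mul_add]
  | monomial u a =>
    have key : (MvPolynomial.mkDerivation ℂ
        (fun n : ℕ+ => ((n : ℕ) : ℂ) • (MvPolynomial.X n : Fock)) : Derivation ℂ Fock Fock)
        (MvPolynomial.monomial u a) = (monomialWeight u : ℂ) • MvPolynomial.monomial u a := by
      rw [MvPolynomial.mkDerivation_monomial, monomialWeight, Finsupp.sum, Finsupp.sum,
        Nat.cast_sum, Finset.sum_smul, Finset.smul_sum]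
      refine Finset.sum_congr rfl fun i hi => ?_
      have hi' : u - Finsupp.single i 1 + Finsupp.single i 1 = u := by
        refine tsub_add_cancel_of_le ?_
        rw [Finsupp.single_le_iff]
        exact Nat.one_le_iff_ne_zero.mpr (Finsupp.mem_support_iff.mp hi)
      rw [MvPolynomial.X, smul_eq_mul, mul_smul_comm, MvPolynomial.monomial_mul, hi']
      simp only [MvPolynomial.smul_monomial, smul_eq_mul]
      congr 1
      push_cast
      ring
    rw [key, MvPolynomial.coeff_smul, smul_eq_mul, MvPolynomial.coeff_monomial]
    split_ifs with h
    · rw [h]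
    · simp

/-- The derivation in `L(0)` is diagonal on monomials, so the eigenvalue equation can be read
coefficient by coefficient. -/
theorem mem_eigenspace_fockL0 (p : ℕ) (wt : ℂ) (d : ℕ) (φ : Fock) :
    φ ∈ (fockL0 p wt).eigenspace (confDim p wt + d) ↔
      φ ∈ MvPolynomial.restrictSupport ℂ {s | monomialWeight s = d} := by
  rw [Module.End.mem_eigenspace_iff, MvPolynomial.mem_restrictSupport_iff]
  have h1 : fockL0 p wt φ = (confDim p wt + d) • φ ↔
      ∀ s, (monomialWeight s : ℂ) * φ.coeff s = d * φ.coeff s := by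
    rw [MvPolynomial.ext_iff]
    refine forall_congr' fun s => ?_
    rw [fockL0, LinearMap.add_apply, MvPolynomial.coeff_add, MvPolynomial.coeff_smul]
    erw [coeff_weightDerivation]
    simp only [LinearMap.smul_apply, LinearMap.id_apply, MvPolynomial.coeff_smul, smul_eq_mul,
      add_mul, add_right_inj]
  rw [h1]
  constructor
  · intro h s hs
    have := mul_right_cancel₀ (MvPolynomial.mem_support_iff.mp hs) (h s)
    exact_mod_cast this
  · intro h s
    by_cases hs : φ.coeff s = 0
    · simp [hs]
    · have : monomialWeight s = d := h (MvPolynomial.mem_support_iff.mpr hs)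
      rw [this]

theorem finrank_eigenspace_fockL0 (p : ℕ) (wt : ℂ) (d : ℕ) :
    Module.finrank ℂ ((fockL0 p wt).eigenspace (confDim p wt + d)) = levelDim d := by
  have h : (fockL0 p wt).eigenspace (confDim p wt + d) =
      MvPolynomial.restrictSupport ℂ {s | monomialWeight s = d} :=
    Submodule.ext fun φ => mem_eigenspace_fockL0 p wt d φ
  rw [h, Module.finrank_eq_nat_card_basis (MvPolynomial.basisRestrictSupport ℂ _)]
  rfl

/-- Euler's product: a finite set of exponent vectors lies in a box with indices in `S` and
exponents below `K`. The sum over the box factors into geometric sums, and these products are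
bounded independently of the box. -/
theorem summable_pow_monomialWeight {q : ℝ} (h0 : 0 < q) (h1 : q < 1) :
    Summable fun s : ℕ+ →₀ ℕ => q ^ monomialWeight s := by
  classical
  have hq : ∀ n : ℕ+, q ^ (n : ℕ) < 1 := fun n => pow_lt_one₀ h0.le h1 n.ne_zero
  have hgeo : Summable fun n : ℕ+ => q ^ (n : ℕ) :=
    (summable_geometric_of_lt_one h0.le h1).comp_injective PNat.coe_injective
  refine summable_of_sum_le (c := Real.exp ((1 - q)⁻¹ * ∑' n : ℕ+, q ^ (n : ℕ)))
    (fun s => by positivity) fun A => ?_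
  set S : Finset ℕ+ := A.biUnion fun s => s.support with hS
  set K : ℕ := (A.sup fun s => S.sup s) + 1 with hK
  have hsub : ∀ s ∈ A, s.support ⊆ S := fun s hs =>
    Finset.subset_biUnion_of_mem (fun s : ℕ+ →₀ ℕ => s.support) hs
  have hlt : ∀ s ∈ A, ∀ n ∈ S, s n < K := fun s hs n hn => by
    refine Nat.lt_succ_of_le ?_
    exact (Finset.le_sup (f := s) hn).trans (Finset.le_sup (f := fun s : ℕ+ →₀ ℕ => S.sup s) hs)
  have hprod : ∏ n ∈ S, ∑ k ∈ Finset.range K, (q ^ (n : ℕ)) ^ k ≤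
      Real.exp ((1 - q)⁻¹ * ∑' n : ℕ+, q ^ (n : ℕ)) := by
    calc ∏ n ∈ S, ∑ k ∈ Finset.range K, (q ^ (n : ℕ)) ^ k
        ≤ ∏ n ∈ S, Real.exp ((1 - q)⁻¹ * q ^ (n : ℕ)) := by
          refine Finset.prod_le_prod (fun n _ => by positivity) fun n _ => ?_
          have hn : q ^ (n : ℕ) ≤ q := by
            simpa using pow_le_pow_of_le_one h0.le h1.le (PNat.pos n)
          -- With `x = qⁿ ≤ q`: `1/(1 - x) = 1 + x/(1 - x) ≤ 1 + x/(1 - q) ≤ exp(x/(1 - q))`.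
          calc ∑ k ∈ Finset.range K, (q ^ (n : ℕ)) ^ k ≤ (1 - q ^ (n : ℕ))⁻¹ := by
                rw [← tsum_geometric_of_lt_one (by positivity) (hq n)]
                exact (summable_geometric_of_lt_one (by positivity) (hq n)).sum_le_tsum _
                  fun _ _ => by positivity
            _ ≤ (1 - q)⁻¹ * q ^ (n : ℕ) + 1 := by
                have ha : 0 < 1 - q := by linarith
                have hb : 0 < 1 - q ^ (n : ℕ) := by linarith
                rw [inv_eq_one_div, div_le_iff₀ hb]
                have h2 : (1 - q)⁻¹ * (1 - q ^ (n : ℕ)) ≥ 1 := by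
                  rw [ge_iff_le, inv_mul_eq_div, le_div_iff₀ ha]; linarith
                have h3 : 0 < q ^ (n : ℕ) := by positivity
                nlinarith
            _ ≤ _ := Real.add_one_le_exp _
      _ = Real.exp ((1 - q)⁻¹ * ∑ n ∈ S, q ^ (n : ℕ)) := by
          rw [← Real.exp_sum, Finset.mul_sum]
      _ ≤ _ := by
          have ha : 0 < 1 - q := by linarith
          have := hgeo.sum_le_tsum S fun _ _ => by positivity
          gcongr
  refine le_trans ?_ hprod
  rw [Finset.prod_sum]
  have hinj : Set.InjOn (fun (s : ℕ+ →₀ ℕ) (n : ℕ+) (_ : n ∈ S) => s n) (A : Set (ℕ+ →₀ ℕ)) := by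
    intro s hs t ht hst
    ext n
    by_cases hn : n ∈ S
    · exact congrFun (congrFun hst n) hn
    · rw [Finsupp.notMem_support_iff.mp fun h => hn (hsub s hs h),
        Finsupp.notMem_support_iff.mp fun h => hn (hsub t ht h)]
  calc ∑ s ∈ A, q ^ monomialWeight s
      = ∑ s ∈ A, ∏ x ∈ S.attach, (q ^ ((x.1 : ℕ+) : ℕ)) ^ (s x.1) := by
        refine Finset.sum_congr rfl fun s hs => ?_
        rw [Finset.prod_attach S fun x => (q ^ (x : ℕ)) ^ (s x), monomialWeight,
          Finsupp.sum_of_support_subset s (hsub s hs) _ (by simp), ← Finset.prod_pow_eq_pow_sum]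
        refine Finset.prod_congr rfl fun x _ => ?_
        rw [mul_comm, pow_mul]
    _ = ∑ f ∈ A.image fun (s : ℕ+ →₀ ℕ) (n : ℕ+) (_ : n ∈ S) => s n,
          ∏ x ∈ S.attach, (q ^ ((x.1 : ℕ+) : ℕ)) ^ (f x.1 x.2) :=
        (Finset.sum_image (f := fun f : (n : ℕ+) → n ∈ S → ℕ =>
          ∏ x ∈ S.attach, (q ^ ((x.1 : ℕ+) : ℕ)) ^ (f x.1 x.2)) hinj).symm
    _ ≤ _ := by
        refine Finset.sum_le_sum_of_subset_of_nonneg ?_ fun _ _ _ => by positivity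
        intro f hf
        obtain ⟨s, hs, rfl⟩ := Finset.mem_image.mp hf
        exact Finset.mem_pi.mpr fun n hn => Finset.mem_range.mpr (hlt s hs n hn)

/-- Grouping monomials by weight turns the series into a sum over all monomials, in which the empty
monomial contributes `1`. Summability is essential: a divergent `tsum` would be zero. -/
theorem tsum_levelDim_pos {q : ℝ} (h0 : 0 < q) (h1 : q < 1) :
    0 < ∑' d : ℕ, (levelDim d : ℝ) * q ^ d := by
  have hs := summable_pow_monomialWeight h0 h1
  have hs' := (Equiv.sigmaFiberEquiv monomialWeight).summable_iff.mpr hs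
  have e1 : ∀ d : ℕ, ∑' c : {s // monomialWeight s = d},
      ((fun s => q ^ monomialWeight s) ∘ Equiv.sigmaFiberEquiv monomialWeight) ⟨d, c⟩ =
      (levelDim d : ℝ) * q ^ d := fun d => by
    have : ∀ c : {s // monomialWeight s = d},
      ((fun s => q ^ monomialWeight s) ∘ Equiv.sigmaFiberEquiv monomialWeight) ⟨d, c⟩ = q ^ d :=
        fun c => by simp [Equiv.sigmaFiberEquiv, c.2]
    rw [tsum_congr this, tsum_const, nsmul_eq_mul, levelDim]
  have e2 : ∑' d : ℕ, (levelDim d : ℝ) * q ^ d = ∑' s, q ^ monomialWeight s := by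
    rw [← (Equiv.sigmaFiberEquiv monomialWeight).tsum_eq]
    refine Eq.trans ?_ hs'.tsum_sigma.symm
    exact tsum_congr fun d => (e1 d).symm
  rw [e2]
  exact hs.tsum_pos (fun s => by positivity) 0 (by positivity)

/-- The part of the Fock character at `τ = iy` that does not depend on the weight, that is
`1 / η(iy)`. -/
noncomputable def oscillatorChar (y : ℝ) : ℂ :=
  Complex.exp (Real.pi * y / 12) * ∑' d : ℕ, (levelDim d : ℂ) * Complex.exp (-(2 * Real.pi * y)) ^ d

theorem oscillatorChar_ne_zero {y : ℝ} (hy : 0 < y) : oscillatorChar y ≠ 0 := by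
  have h := tsum_levelDim_pos (Real.exp_pos (-(2 * Real.pi * y)))
    (by rw [Real.exp_lt_one_iff]; simp; positivity)
  refine mul_ne_zero (Complex.exp_ne_zero _) ?_
  have : ∑' d : ℕ, (levelDim d : ℂ) * Complex.exp (-(2 * Real.pi * y)) ^ d =
      ((∑' d : ℕ, (levelDim d : ℝ) * Real.exp (-(2 * Real.pi * y)) ^ d : ℝ) : ℂ) := by
    push_cast
    rfl
  rw [this]
  exact_mod_cast h.ne'

/-- Completing the square: `Δ - c/24 = (λ - α₀/2)²/2 - 1/24`. -/
theorem fockChar_eq (p : ℕ) (wt : ℂ) (y : ℝ) :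
    fockChar p wt (Complex.I * y) =
      Complex.exp (-(Real.pi * y * (wt - alphaZero p / 2) ^ 2)) * oscillatorChar y := by
  rw [fockChar, oscillatorChar, ← mul_assoc (Complex.exp _), ← Complex.exp_add, ← tsum_mul_left]
  refine tsum_congr fun d => ?_
  rw [finrank_eigenspace_fockL0, ← Complex.exp_nat_mul, mul_left_comm (Complex.exp _), ← Complex.exp_add]
  congr 2
  simp only [confDim, centralCharge]
  push_cast
  linear_combination (2 * Real.pi * y * (wt * (wt - alphaZero p) / 2 + d
    - (1 - 3 * (alphaZero p : ℂ) ^ 2) / 24)) * Complex.I_sq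

/-! ### Reduction to Gaussian sums over integers -/

theorem sqrt_two_mul_pos {p : ℕ} (hp : 0 < p) : 0 < √(2 * p : ℝ) :=
  Real.sqrt_pos.mpr (by positivity)

theorem sqrt_two_mul_sq (p : ℕ) : √(2 * p : ℝ) ^ 2 = 2 * p := Real.sq_sqrt (by positivity)

theorem ofReal_sqrt_two_mul_ne_zero {p : ℕ} (hp : 0 < p) : ((√(2 * p : ℝ) : ℝ) : ℂ) ≠ 0 :=
  Complex.ofReal_ne_zero.mpr (sqrt_two_mul_pos hp).ne'

theorem natCast_eq_sqrt_sq_div_two (p : ℕ) : (p : ℂ) = ((√(2 * p : ℝ) : ℝ) : ℂ) ^ 2 / 2 := by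
  rw [← Complex.ofReal_pow, sqrt_two_mul_sq]
  push_cast
  ring

/-- The summand `e^{2πεN/√(2p) - πyN²/(2p)}`: up to the oscillator factor, the regularised
character at `τ = iy` of the Fock module with `λ - α₀/2 = N/√(2p)`. -/
noncomputable def fockTerm (p : ℕ) (ε : ℂ) (y : ℝ) (N : ℤ) : ℂ :=
  Complex.exp (2 * Real.pi * ε * N / (√(2 * p : ℝ) : ℝ) - Real.pi * y * N ^ 2 / (2 * p))

theorem fockWeight_sub_half {p : ℕ} (hp : 0 < p) (s n : ℤ) :
    fockWeight p 1 s n - alphaZero p / 2 = (s + p * (n - 1)) / √(2 * p : ℝ) := by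
  have ha := sqrt_two_mul_pos hp
  have h2 : √(2 / p : ℝ) = 2 / √(2 * p : ℝ) := by
    rw [eq_div_iff ha.ne', ← Real.sqrt_mul (by positivity)]
    have : (2 / p * (2 * p) : ℝ) = 2 ^ 2 := by
      have : (p : ℝ) ≠ 0 := by positivity
      field_simp
    rw [this, Real.sqrt_sq (by norm_num)]
  have hsq := sqrt_two_mul_sq p
  rw [fockWeight, alphaZero, h2]
  field_simp
  push_cast
  linear_combination (n - 1 : ℝ) / 2 * hsq * 2

theorem regFockChar_eq {p : ℕ} (hp : 0 < p) (ε : ℂ) (y : ℝ) (s n : ℤ) :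
    regFockChar p ε (fockWeight p 1 s n) (Complex.I * y) =
      fockTerm p ε y (s + p * (n - 1)) * oscillatorChar y := by
  have h : (fockWeight p 1 s n : ℂ) - alphaZero p / 2 =
      (s + p * (n - 1)) / ((√(2 * p : ℝ) : ℝ) : ℂ) := by
    exact_mod_cast congrArg (Complex.ofReal) (fockWeight_sub_half hp s n)
  rw [regFockChar, fockChar_eq, h, ← mul_assoc, ← Complex.exp_add, fockTerm]
  congr 2
  have ha := ofReal_sqrt_two_mul_ne_zero hp
  have hsq : ((√(2 * p : ℝ) : ℝ) : ℂ) ^ 2 = 2 * p := by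
    rw [natCast_eq_sqrt_sq_div_two p]; ring
  rw [div_pow, hsq]
  push_cast
  ring

/-- The regularised character of `M_{r,s}` at `τ = iy` without the oscillator factor. -/
noncomputable def reducedChar (p : ℕ) (r : ℤ) (s : ℕ) (ε : ℂ) (y : ℝ) : ℂ :=
  if s = p then fockTerm p ε y (p * (r - 1))
  else ∑' j : ℕ, (fockTerm p ε y (p * (r - 2) + s - 2 * p * j) -
    fockTerm p ε y (p * (r - 2) - s - 2 * p * j))

theorem regChar_eq {p : ℕ} (hp : 0 < p) (r : ℤ) (s : ℕ) (ε : ℂ) (y : ℝ) :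
    regChar p r s ε (Complex.I * y) = reducedChar p r s ε y * oscillatorChar y := by
  rw [regChar, reducedChar]
  split_ifs with h
  · have := regFockChar_eq hp ε y p (r - 1)
    rw [this]
    congr 2
    ring
  · rw [← tsum_mul_right]
    refine tsum_congr fun j => ?_
    rw [regFockChar_eq hp, regFockChar_eq hp, ← sub_mul]
    congr 3 <;> ring

theorem charRatio_eq {p : ℕ} (hp : 0 < p) (r : ℤ) (s : ℕ) (ε : ℂ) {y : ℝ} (hy : 0 < y) :
    charRatio p r s ε y = reducedChar p r s ε y / reducedChar p 1 1 ε y := by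
  rw [charRatio, regChar_eq hp, regChar_eq hp, mul_div_mul_right _ _ (oscillatorChar_ne_zero hy)]

/-! ### Poisson summation -/

theorem summable_exp_quadratic {A : ℝ} (hA : 0 < A) (B C : ℂ) :
    Summable fun n : ℤ => Complex.exp (-Real.pi * A * n ^ 2 + 2 * Real.pi * B * n + C) := by
  have h := (summable_jacobiTheta₂_term_iff (-(Complex.I * B)) (Complex.I * A)).mpr (by simpa)
  refine (h.mul_right (Complex.exp C)).congr fun n => ?_
  rw [jacobiTheta₂_term, ← Complex.exp_add]
  congr 1
  linear_combination (-2 * Real.pi * B * n + Real.pi * A * n ^ 2 : ℂ) * Complex.I_sq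

/-- The Gaussian `e^{π(ε - in/√(2p))²/y}` of the dual (Poisson summed) side. -/
noncomputable def dualTerm (p : ℕ) (ε : ℂ) (y : ℝ) (n : ℤ) : ℂ :=
  Complex.exp (Real.pi * (ε - Complex.I * n / (√(2 * p : ℝ) : ℝ)) ^ 2 / y)

theorem fockTerm_quadratic {p : ℕ} (hp : 0 < p) (ε : ℂ) (y : ℝ) (b j : ℤ) :
    fockTerm p ε y (b + 2 * p * j) =
      Complex.exp (-Real.pi * (2 * p * y : ℝ) * j ^ 2 +
        2 * Real.pi * (ε * (√(2 * p : ℝ) : ℝ) - y * b) * j +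
        (2 * Real.pi * ε * b / (√(2 * p : ℝ) : ℝ) - Real.pi * y * b ^ 2 / (2 * p))) := by
  have ha := ofReal_sqrt_two_mul_ne_zero hp
  rw [fockTerm]
  congr 1
  push_cast
  rw [natCast_eq_sqrt_sq_div_two p]
  generalize ((√(2 * p : ℝ) : ℝ) : ℂ) = a at *
  field_simp
  ring

theorem summable_fockTerm {p : ℕ} (hp : 0 < p) (ε : ℂ) {y : ℝ} (hy : 0 < y) (b : ℤ) :
    Summable fun j : ℤ => fockTerm p ε y (b + 2 * p * j) := by
  simp_rw [fockTerm_quadratic hp]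
  exact summable_exp_quadratic (by positivity) _ _

theorem summable_dualTerm {p : ℕ} (hp : 0 < p) (ε : ℂ) {y : ℝ} (hy : 0 < y) :
    Summable (dualTerm p ε y) := by
  have ha := ofReal_sqrt_two_mul_ne_zero hp
  have hy' : (y : ℂ) ≠ 0 := by exact_mod_cast hy.ne'
  refine (summable_exp_quadratic (A := (2 * p * y)⁻¹) (by positivity)
    (-(Complex.I * ε / ((√(2 * p : ℝ) : ℝ) * y))) (Real.pi * ε ^ 2 / y)).congr fun n => ?_
  rw [dualTerm]
  congr 1
  push_cast
  rw [natCast_eq_sqrt_sq_div_two p]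
  generalize ((√(2 * p : ℝ) : ℝ) : ℂ) = a at *
  field_simp
  linear_combination (-(n : ℂ) ^ 2) * Complex.I_sq

/-- Under Poisson summation the shift `b` of the lattice becomes the phase `e^{πinb/p}`, and the
remaining exponent is a perfect square. -/
theorem tsum_fockTerm {p : ℕ} (hp : 0 < p) (ε : ℂ) {y : ℝ} (hy : 0 < y) (b : ℤ) :
    ∑' j : ℤ, fockTerm p ε y (b + 2 * p * j) = 1 / ((2 * p * y : ℝ) : ℂ) ^ (1 / 2 : ℂ) *
      ∑' n : ℤ, Complex.exp (Real.pi * Complex.I * n * b / p) * dualTerm p ε y n := by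
  have ha := ofReal_sqrt_two_mul_ne_zero hp
  have hy' : (y : ℂ) ≠ 0 := by exact_mod_cast hy.ne'
  simp_rw [fockTerm_quadratic hp]
  have hA : 0 < (((2 * p * y : ℝ) : ℝ) : ℂ).re := by
    rw [Complex.ofReal_re]; positivity
  have := Complex.tsum_exp_neg_quadratic hA (ε * (√(2 * p : ℝ) : ℝ) - y * b)
  simp_rw [Complex.exp_add _ (2 * Real.pi * ε * b / _ - _)]
  rw [tsum_mul_right, this, mul_assoc, ← tsum_mul_right]
  congr 1
  refine tsum_congr fun n => ?_
  rw [dualTerm, ← Complex.exp_add, ← Complex.exp_add]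
  congr 1
  push_cast
  rw [natCast_eq_sqrt_sq_div_two p]
  generalize ((√(2 * p : ℝ) : ℝ) : ℂ) = a at *
  field_simp
  ring_nf
  simp only [Complex.I_sq]
  ring

/-- The coefficient of the `n`-th Gaussian in the Poisson summed character of `M_{r,s}`. -/
noncomputable def modeCoeff (p : ℕ) (r : ℤ) (s : ℕ) (n : ℤ) : ℂ :=
  (-1) ^ (n * r) * (2 * Complex.I * (Real.sin (Real.pi * n * s / p) : ℝ))

theorem modeCoeff_eq {p : ℕ} (hp : 0 < p) (r : ℤ) (s : ℕ) (n : ℤ) :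
    Complex.exp (Real.pi * Complex.I * n * (p * (r - 2) + s : ℤ) / p) -
      Complex.exp (Real.pi * Complex.I * n * (p * (r - 2) - s : ℤ) / p) = modeCoeff p r s n := by
  have hp' : (p : ℂ) ≠ 0 := by exact_mod_cast hp.ne'
  have e1 : (Real.pi * Complex.I * n * (p * (r - 2) + s : ℤ) / p : ℂ) =
      (n * (r - 2) : ℤ) * (Real.pi * Complex.I) + (Real.pi * n * s / p) * Complex.I := by
    push_cast; field_simp
  have e2 : (Real.pi * Complex.I * n * (p * (r - 2) - s : ℤ) / p : ℂ) =
      (n * (r - 2) : ℤ) * (Real.pi * Complex.I) + -(Real.pi * n * s / p) * Complex.I := by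
    push_cast; field_simp; ring
  have e3 : ((-1 : ℂ)) ^ (n * (r - 2)) = (-1) ^ (n * r) := by
    have : n * (r - 2) = n * r + 2 * (-n) := by ring
    rw [this, zpow_add₀ (by norm_num), zpow_mul (-1 : ℂ) 2]
    norm_num
  rw [e1, e2, Complex.exp_add, Complex.exp_add, Complex.exp_int_mul, Complex.exp_pi_mul_I, e3,
    modeCoeff]
  push_cast
  rw [Complex.sin]
  ring_nf
  simp only [Complex.I_sq]
  ring

theorem norm_modeCoeff_le (p : ℕ) (r : ℤ) (s : ℕ) (n : ℤ) : ‖modeCoeff p r s n‖ ≤ 2 := by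
  rw [modeCoeff, norm_mul, norm_zpow, norm_neg, norm_one, one_zpow, one_mul, norm_mul, norm_mul,
    Complex.norm_I, Complex.norm_real, Real.norm_eq_abs]
  have := Real.abs_sin_le_one (Real.pi * n * s / p)
  norm_num
  exact this

/-- This vanishing is why multiples of `p` are left out of the wall and why the strips `m = 0, p`
are exceptional. -/
theorem modeCoeff_eq_zero {p : ℕ} (hp : 0 < p) (r : ℤ) (s : ℕ) {n : ℤ} (h : (p : ℤ) ∣ n) :
    modeCoeff p r s n = 0 := by
  obtain ⟨k, rfl⟩ := h
  have hp' : (p : ℝ) ≠ 0 := by exact_mod_cast hp.ne'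
  have : (Real.pi * (p * k : ℤ) * s / p : ℝ) = (k * s : ℤ) * Real.pi := by
    push_cast; field_simp
  rw [modeCoeff, this, Real.sin_int_mul_pi]
  simp

/-! ### The missing half of the theta series -/

/-- The part of the theta series that is missing from the character of `M_{r,s}`. -/
noncomputable def complementSum (p : ℕ) (r : ℤ) (s : ℕ) (ε : ℂ) (y : ℝ) : ℂ :=
  ∑' j : ℕ, (fockTerm p ε y (p * (r - 2) + s + 2 * p * (j + 1)) -
    fockTerm p ε y (p * (r - 2) - s + 2 * p * (j + 1)))

theorem tsum_int_eq_add {g : ℤ → ℂ} (hg : Summable g) :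
    ∑' j, g j = ∑' j : ℕ, g (-(j : ℤ)) + ∑' j : ℕ, g (j + 1) := by
  have i1 : Summable fun j : ℕ => g (-(j : ℤ)) :=
    hg.comp_injective (i := fun j : ℕ => -(j : ℤ)) fun a b h => by simpa using h
  have i2 : Summable fun j : ℕ => g (j + 1) :=
    hg.comp_injective (i := fun j : ℕ => (j : ℤ) + 1) fun a b h => by simpa using h
  have i3 : Summable fun j : ℕ => (fun j => g (-j)) (-((j : ℤ) + 1)) := by simpa using i2
  have := tsum_of_nat_of_neg_add_one (f := fun j => g (-j)) i1 i3
  simp only [neg_neg] at this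
  rw [← this]
  exact ((Equiv.neg ℤ).tsum_eq g).symm

theorem reducedChar_eq_sub {p : ℕ} (hp : 0 < p) (r : ℤ) {s : ℕ} (hs : s ≠ p) (ε : ℂ) {y : ℝ}
    (hy : 0 < y) :
    reducedChar p r s ε y = 1 / ((2 * p * y : ℝ) : ℂ) ^ (1 / 2 : ℂ) *
      (∑' n : ℤ, modeCoeff p r s n * dualTerm p ε y n) - complementSum p r s ε y := by
  set g : ℤ → ℂ := fun j => fockTerm p ε y (p * (r - 2) + s + 2 * p * j) -
    fockTerm p ε y (p * (r - 2) - s + 2 * p * j) with hg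
  have h1 := summable_fockTerm hp ε hy (p * (r - 2) + s)
  have h2 := summable_fockTerm hp ε hy (p * (r - 2) - s)
  have hgs : Summable g := h1.sub h2
  have hd : ∀ b : ℤ, Summable fun n : ℤ =>
      Complex.exp (Real.pi * Complex.I * n * b / p) * dualTerm p ε y n := fun b => by
    refine Summable.of_norm_bounded (summable_dualTerm hp ε hy).norm fun n => ?_
    rw [norm_mul]
    have : (Real.pi * Complex.I * n * b / p : ℂ) = ((Real.pi * n * b / p : ℝ) : ℂ) * Complex.I := by
      push_cast; ring
    rw [this, Complex.norm_exp_ofReal_mul_I, one_mul]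
  have hfull : ∑' j, g j = 1 / ((2 * p * y : ℝ) : ℂ) ^ (1 / 2 : ℂ) *
      (∑' n : ℤ, modeCoeff p r s n * dualTerm p ε y n) := by
    rw [hg, h1.tsum_sub h2, tsum_fockTerm hp ε hy, tsum_fockTerm hp ε hy, ← mul_sub,
      ← (hd _).tsum_sub (hd _)]
    congr 1
    refine tsum_congr fun n => ?_
    rw [← sub_mul, modeCoeff_eq hp]
  have hsplit := tsum_int_eq_add hgs
  rw [← hfull, hsplit, reducedChar, if_neg hs, complementSum]
  have e1 : ∀ j : ℕ, g (-(j : ℤ)) = fockTerm p ε y (p * (r - 2) + s - 2 * p * j) -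
    fockTerm p ε y (p * (r - 2) - s - 2 * p * j) := fun j => by
      simp only [hg]; congr 2 <;> ring
  have e2 : ∀ j : ℕ, g (j + 1) =
      fockTerm p ε y (p * (r - 2) + s + 2 * p * (j + 1)) -
        fockTerm p ε y (p * (r - 2) - s + 2 * p * (j + 1)) := fun j => by
      simp only [hg]
  rw [tsum_congr e1, tsum_congr e2]
  ring

theorem norm_fockTerm_le {p : ℕ} (ε : ℂ) {y : ℝ} (hy : 0 ≤ y) (N : ℤ) :
    ‖fockTerm p ε y N‖ ≤ Real.exp (2 * Real.pi * ε.re / √(2 * p : ℝ) * N) := by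
  rw [fockTerm, Complex.norm_exp, Real.exp_le_exp]
  have h1 : (2 * Real.pi * ε * N / (√(2 * p : ℝ) : ℝ) : ℂ) =
      ((2 * Real.pi * N / √(2 * p : ℝ) : ℝ) : ℂ) * ε := by push_cast; ring
  have h2 : (Real.pi * y * N ^ 2 / (2 * p) : ℂ) = ((Real.pi * y * N ^ 2 / (2 * p) : ℝ) : ℂ) := by
    push_cast; ring
  rw [h1, h2, Complex.sub_re, Complex.re_ofReal_mul, Complex.ofReal_re]
  have h3 : 0 ≤ Real.pi * y * N ^ 2 / (2 * p) := by positivity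
  have h4 : 2 * Real.pi * ε.re / √(2 * p : ℝ) * N = 2 * Real.pi * N / √(2 * p : ℝ) * ε.re := by ring
  linarith

theorem norm_dualTerm (p : ℕ) (ε : ℂ) (y : ℝ) (n : ℤ) :
    ‖dualTerm p ε y n‖ =
      Real.exp (Real.pi * (ε.re ^ 2 - (ε.im - n / √(2 * p : ℝ)) ^ 2) / y) := by
  rw [dualTerm, Complex.norm_exp]
  congr 1
  have h1 : (Real.pi * (ε - Complex.I * n / (√(2 * p : ℝ) : ℝ)) ^ 2 / y : ℂ) =
      ((Real.pi / y : ℝ) : ℂ) * (ε - ((n / √(2 * p : ℝ) : ℝ) : ℂ) * Complex.I) ^ 2 := by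
    push_cast; ring
  rw [h1, Complex.re_ofReal_mul, pow_two, Complex.mul_re]
  simp only [Complex.sub_re, Complex.sub_im, Complex.re_ofReal_mul, Complex.im_ofReal_mul,
    Complex.I_re, Complex.I_im]
  ring

theorem summable_exp_mul_add {β : ℝ} (hβ : β < 0) (α : ℝ) :
    Summable fun j : ℕ => Real.exp (α + j * β) := by
  simp_rw [Real.exp_add]
  exact (Real.summable_exp_nat_mul_iff.mpr hβ).mul_left _

/-- The indices `N` of the missing half tend to `+∞`, so for `Re ε < 0` dropping the factor
`e^{-πyN²/(2p)}` leaves a convergent geometric majorant, uniform in `y`. -/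
theorem exists_norm_complementSum_le {p : ℕ} (hp : 0 < p) (r : ℤ) (s : ℕ) {ε : ℂ}
    (hε : ε.re < 0) : ∃ C, ∀ y : ℝ, 0 < y → ‖complementSum p r s ε y‖ ≤ C := by
  have ha := sqrt_two_mul_pos hp
  set κ : ℝ := 2 * Real.pi * ε.re / √(2 * p : ℝ) with hκ
  have hκ0 : κ < 0 := div_neg_of_neg_of_pos (by nlinarith [Real.pi_pos]) ha
  have hp' : (0 : ℝ) < p := by exact_mod_cast hp
  have hsum : ∀ b : ℤ, Summable fun j : ℕ => Real.exp (κ * (b + 2 * p * (j + 1) : ℤ)) :=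
    fun b => by
      refine (summable_exp_mul_add (β := κ * (2 * p)) (by nlinarith)
        (κ * (b + 2 * p))).congr fun j => ?_
      congr 1
      push_cast
      ring
  refine ⟨_, fun y hy => tsum_of_norm_bounded
    ((hsum (p * (r - 2) + s)).add (hsum (p * (r - 2) - s))).hasSum fun j => ?_⟩
  exact (norm_sub_le _ _).trans
    (add_le_add (norm_fockTerm_le ε hy.le _) (norm_fockTerm_le ε hy.le _))

/-! ### Asymptotics by dominant Gaussians -/

theorem tendsto_exp_neg_div {c : ℝ} (hc : 0 < c) :
    Tendsto (fun y : ℝ => Real.exp (-c / y)) (𝓝[>] 0) (𝓝 0) := by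
  have h := tendsto_inv_nhdsGT_zero.const_mul_atTop_of_neg (neg_lt_zero.mpr hc)
  exact Real.tendsto_exp_atBot.comp (h.congr fun y => (div_eq_mul_inv _ _).symm)

/-- The normalisation that makes the dominant Gaussians at distance `√D` unimodular. -/
noncomputable def gaussianScale (ε : ℂ) (D y : ℝ) : ℂ :=
  (Real.exp (-(Real.pi * (ε.re ^ 2 - D)) / y) : ℝ)

theorem norm_gaussianScale (ε : ℂ) (D y : ℝ) :
    ‖gaussianScale ε D y‖ = Real.exp (-(Real.pi * (ε.re ^ 2 - D)) / y) := by
  rw [gaussianScale, Complex.norm_real, Real.norm_eq_abs, Real.abs_exp]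

theorem norm_gaussianScale_mul_dualTerm (p : ℕ) (ε : ℂ) (D y : ℝ) (n : ℤ) :
    ‖gaussianScale ε D y * dualTerm p ε y n‖ =
      Real.exp (-(Real.pi * ((ε.im - n / √(2 * p : ℝ)) ^ 2 - D)) / y) := by
  rw [norm_mul, norm_gaussianScale, norm_dualTerm, ← Real.exp_add]
  congr 1
  ring

theorem norm_gaussianScale_mul_dualTerm_le (p : ℕ) (ε : ℂ) {D y : ℝ} (hy0 : 0 < y) (hy1 : y ≤ 1)
    {n : ℤ} (hn : D ≤ (ε.im - n / √(2 * p : ℝ)) ^ 2) :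
    ‖gaussianScale ε D y * dualTerm p ε y n‖ ≤ ‖gaussianScale ε D 1 * dualTerm p ε 1 n‖ := by
  rw [norm_gaussianScale_mul_dualTerm, norm_gaussianScale_mul_dualTerm, Real.exp_le_exp, neg_div,
    neg_div, neg_le_neg_iff]
  exact div_le_div_of_nonneg_left (mul_nonneg Real.pi_pos.le (by linarith)) hy0 hy1

/-- Dominated convergence: the scaled Gaussians outside `L` shrink with `y`, so their values at `y =
1` serve as majorant. Multiples of `p` need no distance bound because their coefficients vanish. -/
theorem tendsto_tsum_subdominant {p : ℕ} (hp : 0 < p) (r : ℤ) (s : ℕ) (ε : ℂ) {D : ℝ}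
    (L : Finset ℤ)
    (hL : ∀ n : ℤ, n ∉ L → ¬ (p : ℤ) ∣ n → D < (ε.im - n / √(2 * p : ℝ)) ^ 2) :
    Tendsto (fun y : ℝ => ∑' n : ℤ, if n ∈ L then 0 else
      modeCoeff p r s n * (gaussianScale ε D y * dualTerm p ε y n)) (𝓝[>] 0) (𝓝 0) := by
  have hb : Summable fun n : ℤ => 2 * ‖gaussianScale ε D 1 * dualTerm p ε 1 n‖ :=
    ((summable_dualTerm hp ε one_pos).mul_left _).norm.mul_left 2
  have hle : ∀ y : ℝ, 0 < y → ∀ n : ℤ, ‖modeCoeff p r s n *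
      (gaussianScale ε D y * dualTerm p ε y n)‖ ≤ 2 * ‖gaussianScale ε D y * dualTerm p ε y n‖ :=
    fun y hy n => by
      rw [norm_mul]
      exact mul_le_mul_of_nonneg_right (norm_modeCoeff_le p r s n) (norm_nonneg _)
  have := tendsto_tsum_of_dominated_convergence (𝓕 := 𝓝[>] (0 : ℝ))
    (f := fun y n => if n ∈ L then 0 else
      modeCoeff p r s n * (gaussianScale ε D y * dualTerm p ε y n)) (g := fun _ => 0) hb ?_ ?_
  · simpa using this
  · intro n
    by_cases hn : n ∈ L
    · simp [hn]
    by_cases hpn : (p : ℤ) ∣ n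
    · simp [modeCoeff_eq_zero hp r s hpn]
    simp only [hn, if_false]
    have h0 := (tendsto_exp_neg_div (mul_pos Real.pi_pos (sub_pos.mpr (hL n hn hpn)))).const_mul 2
    rw [mul_zero] at h0
    refine squeeze_zero_norm' ?_ h0
    filter_upwards [self_mem_nhdsWithin] with y hy
    rw [← norm_gaussianScale_mul_dualTerm]
    exact hle y hy n
  · filter_upwards [self_mem_nhdsWithin, Ioc_mem_nhdsGT (zero_lt_one' ℝ)] with y hy hy1 n
    by_cases hn : n ∈ L
    · simp only [hn, if_true, norm_zero]; positivity
    by_cases hpn : (p : ℤ) ∣ n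
    · simp only [modeCoeff_eq_zero hp r s hpn, zero_mul, ite_self, norm_zero]; positivity
    simp only [hn, if_false]
    refine (hle y hy n).trans ?_
    exact mul_le_mul_of_nonneg_left
      (norm_gaussianScale_mul_dualTerm_le p ε hy hy1.2 (hL n hn hpn).le) (by norm_num)

/-- The scale by which the character is multiplied in the limit `y → 0+`. -/
noncomputable def charScale (p : ℕ) (ε : ℂ) (D y : ℝ) : ℂ :=
  ((2 * p * y : ℝ) : ℂ) ^ (1 / 2 : ℂ) * gaussianScale ε D y

theorem charScale_ne_zero {p : ℕ} (hp : 0 < p) (ε : ℂ) (D : ℝ) {y : ℝ} (hy : 0 < y) :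
    charScale p ε D y ≠ 0 := by
  refine mul_ne_zero ?_ ?_
  · rw [Complex.cpow_ne_zero_iff]
    left
    have : 2 * p * y ≠ 0 := by positivity
    exact_mod_cast this
  · exact Complex.ofReal_ne_zero.mpr (Real.exp_pos _).ne'

theorem tendsto_charScale {p : ℕ} (hp : 0 < p) {ε : ℂ} {D : ℝ} (hD : D < ε.re ^ 2) :
    Tendsto (charScale p ε D) (𝓝[>] 0) (𝓝 0) := by
  have h0 := (tendsto_exp_neg_div (mul_pos Real.pi_pos (sub_pos.mpr hD))).const_mul
    ((2 * p : ℝ) ^ (1 / 2 : ℝ))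
  rw [mul_zero] at h0
  refine squeeze_zero_norm' ?_ h0
  filter_upwards [Ioc_mem_nhdsGT (zero_lt_one' ℝ)] with y hy
  have hy0 : 0 < y := hy.1
  rw [charScale, norm_mul, norm_gaussianScale,
    Complex.norm_cpow_eq_rpow_re_of_pos (by positivity)]
  have h2 : ((1 / 2 : ℂ)).re = 1 / 2 := by norm_num
  rw [h2]
  refine mul_le_mul_of_nonneg_right (Real.rpow_le_rpow (by positivity) ?_ (by norm_num))
    (Real.exp_pos _).le
  exact mul_le_of_le_one_right (by positivity) hy.2

theorem tendsto_charScale_mul_of_bounded {p : ℕ} (hp : 0 < p) {ε : ℂ} {D : ℝ}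
    (hD : D < ε.re ^ 2) {f : ℝ → ℂ} (hf : ∃ C, ∀ y : ℝ, 0 < y → ‖f y‖ ≤ C) :
    Tendsto (fun y => charScale p ε D y * f y) (𝓝[>] 0) (𝓝 0) := by
  obtain ⟨C, hC⟩ := hf
  have h0 := (tendsto_charScale hp hD).norm.mul_const C
  rw [norm_zero, zero_mul] at h0
  refine squeeze_zero_norm' ?_ h0
  filter_upwards [self_mem_nhdsWithin] with y hy
  rw [norm_mul]
  exact mul_le_mul_of_nonneg_left (hC y hy) (norm_nonneg _)

theorem modeCoeff_self {p : ℕ} (hp : 0 < p) (r n : ℤ) : modeCoeff p r p n = 0 := by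
  have hp' : (p : ℝ) ≠ 0 := by exact_mod_cast hp.ne'
  have : (Real.pi * n * p / p : ℝ) = n * Real.pi := by field_simp
  rw [modeCoeff, this, Real.sin_int_mul_pi]
  simp

theorem tendsto_charScale_mul_reducedChar {p : ℕ} (hp : 0 < p) (r : ℤ) (s : ℕ) {ε : ℂ} {D : ℝ}
    (hε : ε.re < 0) (hD : D < ε.re ^ 2) (L : Finset ℤ)
    (hL : ∀ n : ℤ, n ∉ L → ¬ (p : ℤ) ∣ n → D < (ε.im - n / √(2 * p : ℝ)) ^ 2) :
    Tendsto (fun y : ℝ => charScale p ε D y * reducedChar p r s ε y -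
      ∑ n ∈ L, modeCoeff p r s n * (gaussianScale ε D y * dualTerm p ε y n)) (𝓝[>] 0) (𝓝 0) := by
  by_cases hs : s = p
  · subst hs
    -- For `s = p` all mode coefficients vanish, and the single Fock term is bounded, so the scaled
    -- character tends to zero as claimed.
    simp only [modeCoeff_self hp, zero_mul, Finset.sum_const_zero, sub_zero]
    refine tendsto_charScale_mul_of_bounded hp hD
      ⟨Real.exp (2 * Real.pi * ε.re / √(2 * s : ℝ) * (s * (r - 1) : ℤ)), fun y hy => ?_⟩
    rw [reducedChar, if_pos rfl]
    exact norm_fockTerm_le ε hy.le _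
  · have h1 := (tendsto_tsum_subdominant hp r s ε L hL).sub
      (tendsto_charScale_mul_of_bounded hp hD (exists_norm_complementSum_le hp r s hε))
    rw [sub_zero] at h1
    refine h1.congr' ?_
    filter_upwards [self_mem_nhdsWithin] with y hy
    have hy : 0 < y := hy
    have hc : ((2 * p * y : ℝ) : ℂ) ^ (1 / 2 : ℂ) ≠ 0 := by
      rw [Complex.cpow_ne_zero_iff]
      left
      have : 2 * p * y ≠ 0 := by positivity
      exact_mod_cast this
    have hsum : Summable fun n : ℤ =>
        modeCoeff p r s n * (gaussianScale ε D y * dualTerm p ε y n) := by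
      refine Summable.of_norm_bounded
        (((summable_dualTerm hp ε hy).mul_left (gaussianScale ε D y)).norm.mul_left 2) fun n => ?_
      rw [norm_mul]
      exact mul_le_mul_of_nonneg_right (norm_modeCoeff_le p r s n) (norm_nonneg _)
    have hsplit : ∑' n : ℤ, modeCoeff p r s n * (gaussianScale ε D y * dualTerm p ε y n) =
        (∑' n : ℤ, if n ∈ L then 0 else
          modeCoeff p r s n * (gaussianScale ε D y * dualTerm p ε y n)) +
        ∑ n ∈ L, modeCoeff p r s n * (gaussianScale ε D y * dualTerm p ε y n) := by
      have hfin : HasSum _ _ := hasSum_sum_of_ne_finset_zero (L := .unconditional ℤ) (s := L) (f := fun n : ℤ => if n ∈ L then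
        modeCoeff p r s n * (gaussianScale ε D y * dualTerm p ε y n) else 0)
        fun n hn => if_neg hn
      have hrest := hsum.hasSum.sub hfin
      have e : (fun n : ℤ => modeCoeff p r s n * (gaussianScale ε D y * dualTerm p ε y n) -
          if n ∈ L then modeCoeff p r s n * (gaussianScale ε D y * dualTerm p ε y n) else 0) =
          fun n : ℤ => if n ∈ L then 0 else
            modeCoeff p r s n * (gaussianScale ε D y * dualTerm p ε y n) := by
        funext n
        split_ifs <;> simp
      rw [e] at hrest
      rw [hrest.tsum_eq, Finset.sum_congr rfl fun n hn => if_pos hn, sub_add_cancel]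
    have hpull : ∑' n : ℤ, modeCoeff p r s n * (gaussianScale ε D y * dualTerm p ε y n) =
        gaussianScale ε D y * ∑' n : ℤ, modeCoeff p r s n * dualTerm p ε y n := by
      rw [← tsum_mul_left]
      exact tsum_congr fun n => by ring
    rw [eq_sub_iff_add_eq, sub_add_eq_add_sub, ← hsplit, hpull, reducedChar_eq_sub hp r hs ε hy,
      charScale]
    field_simp

/-- The comparison function `w` need not converge, only stay away from zero. This admits the
oscillating sine on the centre lines. -/
theorem tendsto_div_of_sub_mul {l : Filter ℝ} {F G w : ℝ → ℂ} {A B : ℂ} {δ : ℝ} (hδ : 0 < δ)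
    (hB : B ≠ 0) (hF : Tendsto (fun y => F y - A * w y) l (𝓝 0))
    (hG : Tendsto (fun y => G y - B * w y) l (𝓝 0)) (hw : ∀ᶠ y in l, δ ≤ ‖w y‖) :
    (∀ᶠ y in l, G y ≠ 0) ∧ Tendsto (fun y => F y / G y) l (𝓝 (A / B)) := by
  have key : ∀ {H : ℝ → ℂ} {K : ℂ}, Tendsto (fun y => H y - K * w y) l (𝓝 0) →
      Tendsto (fun y => H y / w y) l (𝓝 K) := fun {H K} hH => by
    rw [tendsto_iff_norm_sub_tendsto_zero]
    have h0 := hH.norm.div_const δ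
    rw [norm_zero, zero_div] at h0
    refine squeeze_zero' (Eventually.of_forall fun _ => norm_nonneg _) ?_ h0
    filter_upwards [hw] with y hy
    have hwy : w y ≠ 0 := norm_pos_iff.mp (hδ.trans_le hy)
    rw [div_sub' hwy, norm_div, mul_comm (w y)]
    exact div_le_div_of_nonneg_left (norm_nonneg _) hδ hy
  have hF' := key hF
  have hG' := key hG
  refine ⟨?_, ?_⟩
  · filter_upwards [hG'.eventually_ne hB] with y hy h
    exact hy (by rw [h, zero_div])
  · refine (hF'.div hG' hB).congr' ?_
    filter_upwards [hw] with y hy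
    have hwy : w y ≠ 0 := norm_pos_iff.mp (hδ.trans_le hy)
    exact div_div_div_cancel_right₀ hwy _ _

theorem hasQDimAlong_of_reducedChar {l : Filter ℝ} {p : ℕ} (hp : 0 < p) {r : ℤ} {s : ℕ} {ε d : ℂ}
    (hl : l ≤ 𝓝[>] 0) (h0 : ∀ᶠ y in l, reducedChar p 1 1 ε y ≠ 0)
    (h : Tendsto (fun y => reducedChar p r s ε y / reducedChar p 1 1 ε y) l (𝓝 d)) :
    HasQDimAlong l p r s ε d := by
  have hpos : ∀ᶠ y in l, 0 < y := hl self_mem_nhdsWithin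
  refine ⟨?_, h.congr' ?_⟩
  · filter_upwards [h0, hpos] with y hy hy0
    rw [regChar_eq hp]
    exact mul_ne_zero hy (oscillatorChar_ne_zero hy0)
  · filter_upwards [hpos] with y hy
    exact (charRatio_eq hp r s ε hy).symm

theorem hasQDimAlong_of_dominant {l : Filter ℝ} (hl : l ≤ 𝓝[>] 0) {p : ℕ} (hp : 0 < p) {r : ℤ}
    {s : ℕ} {ε : ℂ} {D : ℝ} (hε : ε.re < 0) (hD : D < ε.re ^ 2) (L : Finset ℤ)
    (hL : ∀ n : ℤ, n ∉ L → ¬ (p : ℤ) ∣ n → D < (ε.im - n / √(2 * p : ℝ)) ^ 2)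
    {w : ℝ → ℂ} {δ : ℝ} (hδ : 0 < δ) (hw : ∀ᶠ y in l, δ ≤ ‖w y‖) {A B : ℂ} (hB : B ≠ 0)
    (hA' : ∀ y, ∑ n ∈ L, modeCoeff p r s n * (gaussianScale ε D y * dualTerm p ε y n) = A * w y)
    (hB' : ∀ y, ∑ n ∈ L, modeCoeff p 1 1 n * (gaussianScale ε D y * dualTerm p ε y n) = B * w y) :
    HasQDimAlong l p r s ε (A / B) := by
  have h1 := (tendsto_charScale_mul_reducedChar hp r s hε hD L hL).mono_left hl
  have h2 := (tendsto_charScale_mul_reducedChar hp 1 1 hε hD L hL).mono_left hl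
  simp only [hA'] at h1
  simp only [hB'] at h2
  obtain ⟨h3, h4⟩ := tendsto_div_of_sub_mul hδ hB h1 h2 hw
  refine hasQDimAlong_of_reducedChar hp hl (h3.mono fun y => right_ne_zero_of_mul) (h4.congr' ?_)
  filter_upwards [hl self_mem_nhdsWithin] with y hy
  exact mul_div_mul_left _ _ (charScale_ne_zero hp ε D hy)

theorem hasQDim_of_nearest {p : ℕ} (hp : 0 < p) {r : ℤ} {s : ℕ} {ε : ℂ} (n : ℤ)
    (hε : ε.re < -|n / √(2 * p : ℝ) - ε.im|)
    (hn : ∀ m : ℤ, m ≠ n → ¬ (p : ℤ) ∣ m →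
      (ε.im - n / √(2 * p : ℝ)) ^ 2 < (ε.im - m / √(2 * p : ℝ)) ^ 2)
    (h0 : modeCoeff p 1 1 n ≠ 0) :
    HasQDim p r s ε (modeCoeff p r s n / modeCoeff p 1 1 n) := by
  have hε0 : ε.re < 0 := hε.trans_le (by simp)
  refine hasQDimAlong_of_dominant le_rfl hp hε0 (D := (ε.im - n / √(2 * p : ℝ)) ^ 2) ?_ {n} ?_
    (w := fun y => gaussianScale ε ((ε.im - n / √(2 * p : ℝ)) ^ 2) y * dualTerm p ε y n)
    one_pos ?_ h0 (fun y => by simp) (fun y => by simp)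
  · rw [sq_lt_sq, abs_sub_comm, abs_of_neg hε0]
    linarith
  · intro m hm
    exact hn m (by simpa using hm)
  · refine Eventually.of_forall fun y => ?_
    rw [norm_gaussianScale_mul_dualTerm]
    simp

/-! ### Ratios of mode coefficients -/

theorem neg_one_zpow_congr {a b : ℤ} (h : Even (a - b)) : (-1 : ℂ) ^ a = (-1) ^ b := by
  have : a = (a - b) + b := by ring
  rw [this, zpow_add₀ (by norm_num), h.neg_one_zpow, one_mul]

theorem sin_pi_mul_div_ne_zero {p : ℕ} (hp : 0 < p) {n : ℤ} (hn : ¬ (p : ℤ) ∣ n) :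
    Real.sin (Real.pi * n / p) ≠ 0 := by
  intro h
  obtain ⟨j, hj⟩ := Real.sin_eq_zero_iff.mp h
  have hp' : (p : ℝ) ≠ 0 := by exact_mod_cast hp.ne'
  rw [eq_div_iff hp'] at hj
  have : (n : ℝ) = p * j := by
    apply mul_left_cancel₀ Real.pi_ne_zero
    linear_combination -hj
  exact hn ⟨j, by exact_mod_cast this⟩

theorem modeCoeff_one_one_ne_zero {p : ℕ} (hp : 0 < p) {n : ℤ} (hn : ¬ (p : ℤ) ∣ n) :
    modeCoeff p 1 1 n ≠ 0 := by
  have h := sin_pi_mul_div_ne_zero hp hn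
  rw [modeCoeff, Nat.cast_one, mul_one]
  refine mul_ne_zero (zpow_ne_zero _ (by norm_num)) (mul_ne_zero ?_ (Complex.ofReal_ne_zero.mpr ?_))
  · exact mul_ne_zero two_ne_zero Complex.I_ne_zero
  · rwa [mul_one]

theorem modeCoeff_div_modeCoeff (p : ℕ) (r : ℤ) (s : ℕ) (n : ℤ) :
    modeCoeff p r s n / modeCoeff p 1 1 n = (-1) ^ (n * (r - 1)) *
      ((Real.sin (Real.pi * n * s / p) / Real.sin (Real.pi * n / p) : ℝ) : ℂ) := by
  have h : ((-1 : ℂ)) ^ (n * r) = (-1) ^ (n * (r - 1)) * (-1) ^ n := by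
    rw [← zpow_add₀ (by norm_num)]
    congr 1
    ring
  have h2 : (2 * Complex.I) ≠ 0 := mul_ne_zero two_ne_zero Complex.I_ne_zero
  have h3 : ((-1 : ℂ)) ^ n ≠ 0 := zpow_ne_zero _ (by norm_num)
  rw [modeCoeff, modeCoeff, Nat.cast_one, mul_one, mul_one, h, mul_assoc, mul_div_assoc,
    mul_div_mul_left _ _ h3, mul_div_mul_left _ _ h2, Complex.ofReal_div]

theorem modeCoeff_div_eq_genericValue {p : ℕ} (hp : 0 < p) (r : ℤ) (s : ℕ) (k : ℤ) (m : ℕ) :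
    modeCoeff p r s (2 * p * k + m) / modeCoeff p 1 1 (2 * p * k + m) = genericValue p r s m := by
  have hp' : (p : ℝ) ≠ 0 := by exact_mod_cast hp.ne'
  have e1 : (Real.pi * (2 * p * k + m : ℤ) * s / p : ℝ) =
      Real.pi * m * s / p + (k * s : ℤ) * (2 * Real.pi) := by
    push_cast; field_simp; ring
  have e2 : (Real.pi * (2 * p * k + m : ℤ) / p : ℝ) =
      Real.pi * m / p + k * (2 * Real.pi) := by
    push_cast; field_simp; ring
  rw [modeCoeff_div_modeCoeff, genericValue, e1, e2, Real.sin_add_int_mul_two_pi,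
    Real.sin_add_int_mul_two_pi, neg_one_zpow_congr]
  exact ⟨p * k * (r - 1), by ring⟩

/-- The sine is odd about multiples of `π`, while the parity of `(pq + e)r` does not depend on the
sign of `e`. Hence the two neighbours of `pq` carry opposite coefficients. -/
theorem modeCoeff_mul_add {p : ℕ} (hp : 0 < p) (r : ℤ) (s : ℕ) (q e : ℤ) (he : e = 1 ∨ e = -1) :
    modeCoeff p r s (p * q + e) = e * ((-1) ^ ((p * q + 1) * r + q * s) *
      (2 * Complex.I * (Real.sin (Real.pi * s / p) : ℝ))) := by
  have hp' : (p : ℝ) ≠ 0 := by exact_mod_cast hp.ne'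
  have h1 : Real.sin (Real.pi * (p * q + e : ℤ) * s / p) =
      e * ((-1) ^ (q * s : ℤ) * Real.sin (Real.pi * s / p)) := by
    have e1 : (Real.pi * (p * q + e : ℤ) * s / p : ℝ) =
        e * (Real.pi * s / p) + (q * s : ℤ) * Real.pi := by
      push_cast; field_simp; ring
    rw [e1, Real.sin_add_int_mul_pi]
    rcases he with rfl | rfl <;> simp
  have h2 : (-1 : ℂ) ^ ((p * q + e) * r) = (-1) ^ ((p * q + 1) * r) := by
    refine neg_one_zpow_congr ?_
    rcases he with rfl | rfl
    · simp
    · exact ⟨-r, by ring⟩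
  rw [modeCoeff, h1, h2, zpow_add₀ (by norm_num)]
  push_cast
  ring

/-- The common value, up to sign, of the two coefficients next to a multiple `pq` of `p`. -/
noncomputable def adjacentCoeff (p : ℕ) (r : ℤ) (s : ℕ) (q : ℤ) : ℂ :=
  (-1) ^ ((p * q + 1) * r + q * s) * (2 * Complex.I * (Real.sin (Real.pi * s / p) : ℝ))

theorem adjacentCoeff_div {p : ℕ} (hp : 0 < p) (r : ℤ) (s : ℕ) (k : ℤ) {m : ℕ}
    (hm : m = 0 ∨ m = p) :
    adjacentCoeff p r s (2 * k + (m / p : ℕ)) / adjacentCoeff p 1 1 (2 * k + (m / p : ℕ)) =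
      exceptionalValue p r s m := by
  have hdiv : ((p * (m / p : ℕ) : ℤ)) = m := by
    rcases hm with rfl | rfl
    · simp
    · rw [Nat.div_self hp]; simp
  set b : ℤ := ((m / p : ℕ) : ℤ) with hb
  have h2 : (2 * Complex.I) ≠ 0 := mul_ne_zero two_ne_zero Complex.I_ne_zero
  have h3 : ∀ a : ℤ, ((-1 : ℂ)) ^ a ≠ 0 := fun a => zpow_ne_zero _ (by norm_num)
  have key : (-1 : ℂ) ^ ((p * (2 * k + b) + 1) * r + (2 * k + b) * s) =
      (-1) ^ (((m : ℤ) + 1) * (r - 1) + b * ((s : ℤ) - 1)) *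
        (-1) ^ ((p * (2 * k + b) + 1) * 1 + (2 * k + b) * (1 : ℕ)) := by
    rw [← zpow_add₀ (by norm_num)]
    -- Only parity counts: `p * (m / p) = m` because `m` is `0` or `p`, and the terms with `2k` are
    -- even.
    refine neg_one_zpow_congr ⟨p * k * (r - 1) + k * (s - 1), ?_⟩
    push_cast
    linear_combination (r - 1) * hdiv
  rw [adjacentCoeff, adjacentCoeff, exceptionalValue, ← hb, key, Nat.cast_one, mul_one, mul_one,
    mul_assoc, mul_div_assoc]
  rw [mul_div_mul_left _ _ (h3 _), mul_div_mul_left _ _ h2, Complex.ofReal_div, Nat.cast_one,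
    mul_one]

theorem not_dvd_mul_add {p : ℕ} (hp : 2 ≤ p) (q e : ℤ) (he : e = 1 ∨ e = -1) :
    ¬ (p : ℤ) ∣ p * q + e := by
  intro h
  have h1 : (p : ℤ) ∣ e := (Int.dvd_add_right (Dvd.intro q rfl)).mp h
  have h2 : (p : ℤ) ∣ 1 := by
    rcases he with rfl | rfl
    · exact h1
    · exact (dvd_neg.mp h1)
  have := Int.le_of_dvd one_pos h2
  omega

theorem adjacentCoeff_one_one_ne_zero {p : ℕ} (hp : 2 ≤ p) (q : ℤ) :
    adjacentCoeff p 1 1 q ≠ 0 := by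
  have h := modeCoeff_one_one_ne_zero (by omega : 0 < p) (not_dvd_mul_add hp q 1 (Or.inl rfl))
  rw [modeCoeff_mul_add (by omega) _ _ _ _ (Or.inl rfl)] at h
  exact right_ne_zero_of_mul h

/-! ### The nearest index outside `pℤ` -/

/-- The infimum in the wall is attained at a nearest `n`. The comparison is not strict, so that the
tie on a centre line is covered. -/
theorem lt_neg_abs_of_lt_wall {p : ℕ} {ε : ℂ} (h : ε.re < wall p ε) {n : ℤ}
    (hpn : ¬ (p : ℤ) ∣ n) (hn : ∀ m : ℤ, m ≠ n → ¬ (p : ℤ) ∣ m →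
      (ε.im - n / √(2 * p : ℝ)) ^ 2 ≤ (ε.im - m / √(2 * p : ℝ)) ^ 2) :
    ε.re < -|n / √(2 * p : ℝ) - ε.im| := by
  refine h.trans_le ?_
  rw [wall, neg_le_neg_iff]
  refine le_csInf ⟨_, n, hpn, rfl⟩ ?_
  rintro x ⟨m, hm, rfl⟩
  by_cases hmn : m = n
  · rw [hmn]
  · rw [abs_sub_comm, abs_sub_comm (m / √(2 * p : ℝ))]
    exact sq_le_sq.mp (hn m hmn hm)

/-- The offset of `√(2p) Im ε` from the integer `n`, in terms of which distances on the
imaginary axis are measured. -/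
noncomputable def offset (p : ℕ) (ε : ℂ) (n : ℤ) : ℝ := √(2 * p : ℝ) * ε.im - n

theorem im_sub_sq {p : ℕ} (hp : 0 < p) (ε : ℂ) (n h : ℤ) :
    (ε.im - (n + h : ℤ) / √(2 * p : ℝ)) ^ 2 = (offset p ε n - h) ^ 2 / (2 * p) := by
  have ha := (sqrt_two_mul_pos hp).ne'
  have hsq := sqrt_two_mul_sq p
  rw [offset]
  generalize √(2 * p : ℝ) = a at *
  rw [← hsq, ← div_pow]
  congr 1
  push_cast
  field_simp
  ring

theorem im_sub_sq_lt {p : ℕ} (hp : 0 < p) (ε : ℂ) (n h₁ h₂ : ℤ)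
    (h : (offset p ε n - h₁) ^ 2 < (offset p ε n - h₂) ^ 2) :
    (ε.im - (n + h₁ : ℤ) / √(2 * p : ℝ)) ^ 2 < (ε.im - (n + h₂ : ℤ) / √(2 * p : ℝ)) ^ 2 := by
  rw [im_sub_sq hp, im_sub_sq hp]
  exact div_lt_div_of_pos_right h (by positivity)

theorem abs_offset_lt {p : ℕ} (hp : 0 < p) {k : ℤ} {m : ℕ} {ε : ℂ} (h : ε ∈ strip p k m) :
    |offset p ε (2 * p * k + m)| < 1 / 2 := by
  obtain ⟨h1, h2⟩ := h
  have ha := sqrt_two_mul_pos hp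
  have hp' : (0 : ℝ) < p := by exact_mod_cast hp
  have e : ε.im / √(2 * p : ℝ) * (2 * p) = √(2 * p : ℝ) * ε.im := by
    have hsq := sqrt_two_mul_sq p
    generalize √(2 * p : ℝ) = a at *
    rw [← hsq]
    field_simp
  have h1' := mul_lt_mul_of_pos_right h1 (by positivity : (0 : ℝ) < 2 * p)
  have h2' := mul_lt_mul_of_pos_right h2 (by positivity : (0 : ℝ) < 2 * p)
  rw [e] at h1' h2'
  have e1 : (k + (2 * (m : ℝ) - 1) / (4 * p)) * (2 * p) = 2 * p * k + m - 1 / 2 := by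
    field_simp; ring
  have e2 : (k + (2 * (m : ℝ) + 1) / (4 * p)) * (2 * p) = 2 * p * k + m + 1 / 2 := by
    field_simp; ring
  rw [e1] at h1'
  rw [e2] at h2'
  rw [offset, abs_lt]
  push_cast
  constructor <;> linarith

theorem offset_eq_zero_iff {p : ℕ} (hp : 0 < p) (k : ℤ) (m : ℕ) (ε : ℂ) :
    offset p ε (2 * p * k + m) = 0 ↔ ε.im = (2 * p * k + m) / √(2 * p : ℝ) := by
  have ha := (sqrt_two_mul_pos hp).ne'
  rw [offset, sub_eq_zero, eq_div_iff ha, mul_comm]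
  push_cast
  rfl

theorem sq_lt_sub_int_sq {x : ℝ} (hx : |x| < 1 / 2) {h : ℤ} (hh : h ≠ 0) :
    (x - (0 : ℤ)) ^ 2 < (x - h) ^ 2 := by
  rw [abs_lt] at hx
  push_cast
  rcases lt_or_gt_of_ne hh with h1 | h1
  · have : (h : ℝ) ≤ -1 := by exact_mod_cast Int.le_sub_one_of_lt h1
    nlinarith
  · have : (1 : ℝ) ≤ h := by exact_mod_cast h1
    nlinarith

/-- Once `0` is excluded, the nearest integer to `x` is the unit on the same side as `x`. -/
theorem sub_sign_sq_lt {x : ℝ} (hx : |x| < 1 / 2) {e h : ℤ} (he : e = 1 ∨ e = -1)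
    (hex : 0 < e * x) (h0 : h ≠ 0) (hh : h ≠ e) : (x - e) ^ 2 < (x - h) ^ 2 := by
  rw [abs_lt] at hx
  rcases he with rfl | rfl
  · push_cast at hex ⊢
    rcases lt_or_gt_of_ne h0 with h1 | h1
    · have : (h : ℝ) ≤ -1 := by exact_mod_cast Int.le_sub_one_of_lt h1
      nlinarith
    · have : (2 : ℝ) ≤ h := by exact_mod_cast (by omega : (2 : ℤ) ≤ h)
      nlinarith
  · push_cast at hex ⊢
    rcases lt_or_gt_of_ne h0 with h1 | h1
    · have : (h : ℝ) ≤ -2 := by exact_mod_cast (by omega : h ≤ (-2 : ℤ))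
      nlinarith
    · have : (1 : ℝ) ≤ h := by exact_mod_cast h1
      nlinarith

/-! ### Quantum dimensions in the strips left of the wall -/

theorem hasQDim_generic {p : ℕ} (hp : 0 < p) (r : ℤ) (s : ℕ) {k : ℤ} {m : ℕ}
    (hpm : ¬ p ∣ m) {ε : ℂ} (hε : ε ∈ strip p k m) (hw : ε.re < wall p ε) :
    HasQDim p r s ε (genericValue p r s m) := by
  have hpn : ¬ (p : ℤ) ∣ 2 * p * k + m := by
    rw [Int.dvd_add_right ⟨2 * k, by ring⟩, Int.natCast_dvd_natCast]
    exact hpm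
  have hx := abs_offset_lt hp hε
  have hn : ∀ j : ℤ, j ≠ 2 * p * k + m → ¬ (p : ℤ) ∣ j →
      (ε.im - (2 * p * k + m : ℤ) / √(2 * p : ℝ)) ^ 2 < (ε.im - j / √(2 * p : ℝ)) ^ 2 := by
    intro j hj _
    have := im_sub_sq_lt hp ε (2 * p * k + m) 0 (j - (2 * p * k + m))
      (sq_lt_sub_int_sq hx (sub_ne_zero.mpr hj))
    rwa [add_zero, add_sub_cancel] at this
  rw [← modeCoeff_div_eq_genericValue hp r s k m]
  exact hasQDim_of_nearest hp _ (lt_neg_abs_of_lt_wall hw hpn fun j h1 h2 => (hn j h1 h2).le) hn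
    (modeCoeff_one_one_ne_zero hp hpn)

theorem eq_mul_quotient {p : ℕ} (hp : 0 < p) (k : ℤ) {m : ℕ} (hm : m = 0 ∨ m = p) :
    (2 * p * k + m : ℤ) = p * (2 * k + (m / p : ℕ)) := by
  rcases hm with rfl | rfl
  · simp; ring
  · rw [Nat.div_self hp]; push_cast; ring

theorem hasQDim_exceptional {p : ℕ} (hp : 2 ≤ p) (r : ℤ) (s : ℕ) {k : ℤ} {m : ℕ}
    (hm : m = 0 ∨ m = p) {ε : ℂ} (hε : ε ∈ strip p k m) (hw : ε.re < wall p ε)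
    (him : ε.im ≠ (2 * p * k + m) / √(2 * p : ℝ)) :
    HasQDim p r s ε (exceptionalValue p r s m) := by
  have hp0 : 0 < p := by omega
  have hx := abs_offset_lt hp0 hε
  have hx0 : offset p ε (2 * p * k + m) ≠ 0 := fun h => him ((offset_eq_zero_iff hp0 k m ε).mp h)
  have hnq := eq_mul_quotient hp0 k hm
  set n : ℤ := 2 * p * k + m with hn
  set q : ℤ := 2 * k + (m / p : ℕ) with hq
  -- `e` is the sign of the offset, so `n + e` is the neighbour on the side of `ε`.
  obtain ⟨e, he, hex⟩ : ∃ e : ℤ, (e = 1 ∨ e = -1) ∧ 0 < e * offset p ε n := by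
    rcases lt_or_gt_of_ne hx0 with h | h
    · exact ⟨-1, Or.inr rfl, by push_cast; linarith⟩
    · exact ⟨1, Or.inl rfl, by push_cast; linarith⟩
  have hpn : ¬ (p : ℤ) ∣ n + e := by
    rw [hnq]; exact not_dvd_mul_add hp q e he
  have hlt : ∀ j : ℤ, j ≠ n + e → ¬ (p : ℤ) ∣ j →
      (ε.im - (n + e : ℤ) / √(2 * p : ℝ)) ^ 2 < (ε.im - j / √(2 * p : ℝ)) ^ 2 := by
    intro j hj hpj
    -- The centre `n` is a multiple of `p` and thus no competitor.
    have hjn : j - n ≠ 0 := fun h => hpj ⟨q, by rw [← hnq]; linarith⟩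
    have := im_sub_sq_lt hp0 ε n e (j - n)
      (sub_sign_sq_lt hx he hex hjn fun h => hj (by rw [← h]; ring))
    rwa [add_sub_cancel] at this
  have hval : modeCoeff p r s (n + e) / modeCoeff p 1 1 (n + e) = exceptionalValue p r s m := by
    have he0 : (e : ℂ) ≠ 0 := by rcases he with rfl | rfl <;> simp
    rw [← adjacentCoeff_div hp0 r s k hm, hnq, modeCoeff_mul_add hp0 _ _ _ _ he,
      modeCoeff_mul_add hp0 _ _ _ _ he, mul_div_mul_left _ _ he0]
    rfl
  rw [← hval]
  exact hasQDim_of_nearest hp0 _ (lt_neg_abs_of_lt_wall hw hpn fun j h1 h2 => (hlt j h1 h2).le) hlt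
    (modeCoeff_one_one_ne_zero hp0 hpn)

/-- Both neighbours lie at squared distance `1/(2p)`, so the scale cancels the real part of `(Re ε -
ie/√(2p))²` and only the phase of the cross term is left. -/
theorem gaussianScale_mul_dualTerm_centre {p : ℕ} (hp : 0 < p) {ε : ℂ} {n : ℤ}
    (him : ε.im = n / √(2 * p : ℝ)) {e : ℤ} (he : e = 1 ∨ e = -1) (y : ℝ) :
    gaussianScale ε (1 / (2 * p)) y * dualTerm p ε y (n + e) =
      Complex.exp (-e * ((2 * Real.pi * ε.re / (√(2 * p : ℝ) * y) : ℝ) : ℂ) * Complex.I) := by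
  have ha := ofReal_sqrt_two_mul_ne_zero hp
  have h0 : (ε.re + (n / √(2 * p : ℝ) : ℝ) * Complex.I : ℂ) = ε := by
    rw [← him, Complex.re_add_im]
  have h1 : ε - Complex.I * (n + e : ℤ) / (√(2 * p : ℝ) : ℝ) =
      ε.re - e / (√(2 * p : ℝ) : ℝ) * Complex.I := by
    push_cast at h0 ⊢
    linear_combination -h0
  have he2 : (e : ℂ) ^ 2 = 1 := by rcases he with rfl | rfl <;> simp
  rw [gaussianScale, dualTerm, h1, Complex.ofReal_exp, ← Complex.exp_add]
  congr 1
  push_cast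
  rw [natCast_eq_sqrt_sq_div_two p]
  generalize ((√(2 * p : ℝ) : ℝ) : ℂ) = a at *
  -- At `y = 0` division by zero makes all exponents zero, so the identity holds for every real `y`.
  by_cases hy : (y : ℂ) = 0
  · simp [hy]
  field_simp
  ring_nf
  simp only [Complex.I_sq, he2]
  ring

theorem hasQDimAlong_centre {p : ℕ} (hp : 2 ≤ p) (r : ℤ) (s : ℕ) {k : ℤ} {m : ℕ}
    (hm : m = 0 ∨ m = p) {ε : ℂ} (hw : ε.re < wall p ε)
    (him : ε.im = (2 * p * k + m) / √(2 * p : ℝ)) {δ : ℝ} (hδ : 0 < δ) :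
    HasQDimAlong
      (𝓝[{y : ℝ | 0 < y ∧ δ ≤ |Real.sin (2 * Real.pi * ε.re / (√(2 * p) * y))|}] 0)
      p r s ε (exceptionalValue p r s m) := by
  have hp0 : 0 < p := by omega
  have hx0 := (offset_eq_zero_iff hp0 k m ε).mpr him
  have hnq := eq_mul_quotient hp0 k hm
  have him' : ε.im = (2 * p * k + m : ℤ) / √(2 * p : ℝ) := by rw [him]; push_cast; rfl
  set n : ℤ := 2 * p * k + m with hn
  set q : ℤ := 2 * k + (m / p : ℕ) with hq
  have hpn : ∀ e : ℤ, e = 1 ∨ e = -1 → ¬ (p : ℤ) ∣ n + e := fun e he => by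
    rw [hnq]; exact not_dvd_mul_add hp q e he
  have hD1 : ∀ e : ℤ, e = 1 ∨ e = -1 →
      (ε.im - (n + e : ℤ) / √(2 * p : ℝ)) ^ 2 = 1 / (2 * p) := fun e he => by
    rw [im_sub_sq hp0, hx0]
    rcases he with rfl | rfl <;> simp
  have hlt : ∀ j : ℤ, j ∉ ({n + 1, n + -1} : Finset ℤ) → ¬ (p : ℤ) ∣ j →
      1 / (2 * p) < (ε.im - j / √(2 * p : ℝ)) ^ 2 := by
    intro j hj hpj
    have hjn : j - n ≠ 0 := fun h => hpj ⟨q, by rw [← hnq]; linarith⟩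
    simp only [Finset.mem_insert, Finset.mem_singleton, not_or] at hj
    rw [← hD1 1 (Or.inl rfl)]
    have := im_sub_sq_lt hp0 ε n 1 (j - n) (by
      rw [hx0, zero_sub, zero_sub, neg_sq, neg_sq, sq_lt_sq]
      have : 1 < |j - n| := by
        rcases abs_cases (j - n) with h | h <;> omega
      rw [Int.cast_one, abs_one]
      exact_mod_cast this)
    rwa [add_sub_cancel] at this
  have hle : ∀ j : ℤ, j ≠ n + 1 → ¬ (p : ℤ) ∣ j →
      (ε.im - (n + 1 : ℤ) / √(2 * p : ℝ)) ^ 2 ≤ (ε.im - j / √(2 * p : ℝ)) ^ 2 := by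
    intro j hj hpj
    rw [hD1 1 (Or.inl rfl)]
    by_cases hj' : j = n + -1
    · rw [hj', hD1 (-1) (Or.inr rfl)]
    · exact (hlt j (by simp only [Finset.mem_insert, Finset.mem_singleton]; tauto) hpj).le
  have hre := lt_neg_abs_of_lt_wall hw (hpn 1 (Or.inl rfl)) hle
  have hre0 : ε.re < 0 := hre.trans_le (by simp)
  have hD : 1 / (2 * p) < ε.re ^ 2 := by
    rw [← hD1 1 (Or.inl rfl), sq_lt_sq, abs_sub_comm, abs_of_neg hre0]
    linarith
  set θ : ℝ → ℝ := fun y => 2 * Real.pi * ε.re / (√(2 * p : ℝ) * y) with hθ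
  -- Opposite coefficients meet the phases `e^{∓iθ}`; their difference is `-2i sin θ`, the same
  -- factor for all `r'` and `s'`.
  have hsum : ∀ (r' : ℤ) (s' : ℕ) (y : ℝ), ∑ j ∈ ({n + 1, n + -1} : Finset ℤ),
      modeCoeff p r' s' j * (gaussianScale ε (1 / (2 * p)) y * dualTerm p ε y j) =
      adjacentCoeff p r' s' q * (-2 * Complex.I * (Real.sin (θ y) : ℝ)) := by
    intro r' s' y
    rw [Finset.sum_pair (by omega), gaussianScale_mul_dualTerm_centre hp0 him' (Or.inl rfl),
      gaussianScale_mul_dualTerm_centre hp0 him' (Or.inr rfl), hnq,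
      modeCoeff_mul_add hp0 _ _ _ _ (Or.inl rfl), modeCoeff_mul_add hp0 _ _ _ _ (Or.inr rfl),
      ← adjacentCoeff, Complex.ofReal_sin, Complex.sin]
    simp only [hθ]
    push_cast
    ring_nf
    simp only [Complex.I_sq]
    ring
  rw [← adjacentCoeff_div hp0 r s k hm]
  refine hasQDimAlong_of_dominant (nhdsWithin_mono _ fun y hy => hy.1) hp0 hre0 hD _ hlt hδ ?_
    (adjacentCoeff_one_one_ne_zero hp q) (hsum r s) (hsum 1 1)
  filter_upwards [self_mem_nhdsWithin] with y hy
  have h2 : δ ≤ |Real.sin (θ y)| := hy.2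
  rw [norm_mul, norm_mul, Complex.norm_I, Complex.norm_real, Real.norm_eq_abs]
  norm_num
  linarith

/-! ### The continuous regime -/

/-- The character of `M_{r,s}` at `y = 0` in the region `Re ε > 0`, without the oscillators. -/
noncomputable def continuousValue (p : ℕ) (r : ℤ) (s : ℕ) (ε : ℂ) : ℂ :=
  Complex.exp (2 * Real.pi * ε / (√(2 * p : ℝ) : ℝ) * (p * (r - 1))) *
    Complex.sinh (2 * Real.pi * ε / (√(2 * p : ℝ) : ℝ) * s) /
      Complex.sinh (2 * Real.pi * ε / (√(2 * p : ℝ) : ℝ) * p)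

theorem sinh_ne_zero_of_re_pos {z : ℂ} (hz : 0 < z.re) : Complex.sinh z ≠ 0 := by
  intro h
  rw [Complex.sinh, div_eq_zero_iff, or_iff_left two_ne_zero, sub_eq_zero] at h
  have := congrArg norm h
  rw [Complex.norm_exp, Complex.norm_exp, Real.exp_eq_exp, Complex.neg_re] at this
  linarith

theorem tendsto_fockTerm (p : ℕ) (ε : ℂ) (N : ℤ) :
    Tendsto (fun y => fockTerm p ε y N) (𝓝[>] 0)
      (𝓝 (Complex.exp (2 * Real.pi * ε / (√(2 * p : ℝ) : ℝ) * N))) := by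
  have h : Continuous fun y : ℝ => fockTerm p ε y N := by
    unfold fockTerm
    fun_prop
  have h0 := (h.tendsto 0).mono_left (nhdsWithin_le_nhds (s := Set.Ioi 0))
  have e : fockTerm p ε 0 N = Complex.exp (2 * Real.pi * ε / (√(2 * p : ℝ) : ℝ) * N) := by
    rw [fockTerm]
    congr 1
    push_cast
    ring
  rwa [e] at h0

/-- For `Re ε > 0` the retained half has a geometric majorant uniform in `y`, so the limit may be
taken termwise. For `s = p` the quotient of hyperbolic sines is `1`, which leaves the single Fock
term. -/
theorem tendsto_reducedChar {p : ℕ} (hp : 0 < p) (r : ℤ) (s : ℕ) {ε : ℂ} (hε : 0 < ε.re) :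
    Tendsto (reducedChar p r s ε) (𝓝[>] 0) (𝓝 (continuousValue p r s ε)) := by
  have ha := sqrt_two_mul_pos hp
  have hp' : (0 : ℝ) < p := by exact_mod_cast hp
  set z : ℂ := 2 * Real.pi * ε / (√(2 * p : ℝ) : ℝ) with hz
  set κ : ℝ := 2 * Real.pi * ε.re / √(2 * p : ℝ) with hκ
  have hκ0 : 0 < κ := by positivity
  have hzre : z.re = κ := by
    have : z = ((2 * Real.pi / √(2 * p : ℝ) : ℝ) : ℂ) * ε := by rw [hz]; push_cast; ring
    rw [this, Complex.re_ofReal_mul, hκ]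
    ring
  have hzp : Complex.sinh (z * p) ≠ 0 := by
    refine sinh_ne_zero_of_re_pos ?_
    rw [mul_comm, ← Complex.ofReal_natCast, Complex.re_ofReal_mul, hzre]
    positivity
  by_cases hs : s = p
  · subst hs
    have e : continuousValue s r s ε = Complex.exp (z * (s * (r - 1) : ℤ)) := by
      rw [continuousValue, ← hz, mul_div_assoc, div_self hzp, mul_one]
      push_cast
      rfl
    rw [e]
    refine (tendsto_fockTerm s ε (s * (r - 1))).congr fun y => ?_
    rw [reducedChar, if_pos rfl]
  have hgeo : ∀ b : ℤ, HasSum (fun j : ℕ => Complex.exp (z * (b - 2 * p * j : ℤ)))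
      (Complex.exp (z * b) * (1 - Complex.exp (-(2 * (z * p))))⁻¹) := by
    intro b
    have hn : ‖Complex.exp (-(2 * (z * p)))‖ < 1 := by
      rw [Complex.norm_exp, Real.exp_lt_one_iff]
      have : -(2 * (z * p)) = ((-(2 * p) : ℝ) : ℂ) * z := by push_cast; ring
      rw [this, Complex.re_ofReal_mul, hzre]
      nlinarith [mul_pos hp' hκ0]
    have e : (fun j : ℕ => Complex.exp (z * (b - 2 * p * j : ℤ))) =
        fun j : ℕ => Complex.exp (z * b) * Complex.exp (-(2 * (z * p))) ^ j := by
      funext j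
      rw [← Complex.exp_nat_mul, ← Complex.exp_add]
      congr 1
      push_cast
      ring
    rw [e]
    exact (hasSum_geometric_of_norm_lt_one hn).mul_left _
  have hlim : ∑' j : ℕ, (Complex.exp (z * (p * (r - 2) + s - 2 * p * j : ℤ)) -
      Complex.exp (z * (p * (r - 2) - s - 2 * p * j : ℤ))) = continuousValue p r s ε := by
    rw [((hgeo _).sub (hgeo _)).tsum_eq, continuousValue, ← hz, ← sub_mul]
    have h1 : Complex.exp (z * p) - Complex.exp (-(z * p)) ≠ 0 := by
      intro h
      rw [Complex.sinh, h, zero_div] at hzp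
      exact hzp rfl
    -- Pulling out `e^{-zp}` symmetrises the geometric denominator into `2 sinh(zp)`; the same
    -- factor comes out of the numerator.
    have h2 : 1 - Complex.exp (-(2 * (z * p))) =
        Complex.exp (-(z * p)) * (Complex.exp (z * p) - Complex.exp (-(z * p))) := by
      rw [mul_sub, ← Complex.exp_add, ← Complex.exp_add, neg_add_cancel, Complex.exp_zero]
      congr 2
      ring
    have e1 : z * (p * (r - 2) + s : ℤ) = z * (p * (r - 1)) + z * s + -(z * p) := by
      push_cast; ring
    have e2 : z * (p * (r - 2) - s : ℤ) = z * (p * (r - 1)) + -(z * s) + -(z * p) := by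
      push_cast; ring
    rw [h2, e1, e2, Complex.sinh, Complex.sinh, Complex.exp_add, Complex.exp_add, Complex.exp_add,
      Complex.exp_add]
    have h3 := Complex.exp_ne_zero (-(z * p))
    field_simp
  have hb : ∀ b : ℤ, Summable fun j : ℕ => Real.exp (κ * (b - 2 * p * j : ℤ)) := fun b => by
    refine (summable_exp_mul_add (β := -(κ * (2 * p))) (by nlinarith [mul_pos hp' hκ0])
      (κ * b)).congr fun j => ?_
    congr 1
    push_cast
    ring
  rw [← hlim]
  have hred : reducedChar p r s ε = fun y => ∑' j : ℕ,
      (fockTerm p ε y (p * (r - 2) + s - 2 * p * j) -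
        fockTerm p ε y (p * (r - 2) - s - 2 * p * j)) := by
    funext y
    rw [reducedChar, if_neg hs]
  rw [hred]
  refine tendsto_tsum_of_dominated_convergence ((hb (p * (r - 2) + s)).add (hb (p * (r - 2) - s)))
    (fun j => (tendsto_fockTerm p ε _).sub (tendsto_fockTerm p ε _)) ?_
  filter_upwards [self_mem_nhdsWithin] with y hy j
  have hy : 0 < y := hy
  exact (norm_sub_le _ _).trans
    (add_le_add (norm_fockTerm_le ε hy.le _) (norm_fockTerm_le ε hy.le _))

/-- The quantum dimension in the continuous regime `Re ε > 0`. -/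
noncomputable def continuousQDim (p : ℕ) (r : ℤ) (s : ℕ) (ε : ℂ) : ℂ :=
  Complex.exp (2 * Real.pi * ε / (√(2 * p : ℝ) : ℝ) * (p * (r - 1))) *
    Complex.sinh (2 * Real.pi * ε / (√(2 * p : ℝ) : ℝ) * s) /
      Complex.sinh (2 * Real.pi * ε / (√(2 * p : ℝ) : ℝ))

theorem hasQDim_continuous {p : ℕ} (hp : 0 < p) (r : ℤ) (s : ℕ) {ε : ℂ} (hε : 0 < ε.re) :
    HasQDim p r s ε (continuousQDim p r s ε) := by
  have ha := sqrt_two_mul_pos hp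
  have hre : ∀ c : ℝ, 0 < c → Complex.sinh (2 * Real.pi * ε / (√(2 * p : ℝ) : ℝ) * c) ≠ 0 := by
    intro c hc
    refine sinh_ne_zero_of_re_pos ?_
    have : (2 * Real.pi * ε / (√(2 * p : ℝ) : ℝ) * c : ℂ) =
      ((2 * Real.pi / √(2 * p : ℝ) * c : ℝ) : ℂ) * ε := by push_cast; ring
    rw [this, Complex.re_ofReal_mul]
    positivity
  have h1 := hre 1 one_pos
  have h2 := hre p (by exact_mod_cast hp)
  rw [Complex.ofReal_one, mul_one] at h1
  rw [Complex.ofReal_natCast] at h2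
  have e : continuousValue p 1 1 ε = Complex.sinh (2 * Real.pi * ε / (√(2 * p : ℝ) : ℝ)) /
      Complex.sinh (2 * Real.pi * ε / (√(2 * p : ℝ) : ℝ) * p) := by
    simp [continuousValue]
  have hne : continuousValue p 1 1 ε ≠ 0 := by
    rw [e]
    exact div_ne_zero h1 h2
  have hlim := tendsto_reducedChar hp 1 1 hε
  refine hasQDimAlong_of_reducedChar hp le_rfl (hlim.eventually_ne hne) ?_
  have e2 : continuousQDim p r s ε = continuousValue p r s ε / continuousValue p 1 1 ε := by
    rw [e, continuousQDim, continuousValue, div_div_div_cancel_right₀ h2]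
  rw [e2]
  exact (tendsto_reducedChar hp r s hε).div hlim hne

/-- At the drip point the argument of the denominator is `iπn/p`, where `sinh` is `i sin(πn/p) ≠ 0`
as `p ∤ n`. The formula is therefore continuous there and can be evaluated. -/
theorem tendsto_continuousQDim {p : ℕ} (hp : 0 < p) (r : ℤ) (s : ℕ) (k : ℤ) {m : ℕ}
    (hpm : ¬ p ∣ m) :
    Tendsto (fun t : ℝ => continuousQDim p r s (centrePoint p k m t)) (𝓝[>] 0)
      (𝓝 (genericValue p r s m)) := by
  have hpn : ¬ (p : ℤ) ∣ 2 * p * k + m := by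
    rw [Int.dvd_add_right ⟨2 * k, by ring⟩, Int.natCast_dvd_natCast]
    exact hpm
  have ha := ofReal_sqrt_two_mul_ne_zero hp
  have hp' : (p : ℂ) ≠ 0 := by exact_mod_cast hp.ne'
  set n : ℤ := 2 * p * k + m with hn
  have hpt : ∀ t : ℝ, centrePoint p k m t = t + n / (√(2 * p : ℝ) : ℝ) * Complex.I := by
    intro t
    rw [centrePoint, Complex.mk_eq_add_mul_I, hn]
    push_cast
    rfl
  have hz : (2 * Real.pi * centrePoint p k m 0 / (√(2 * p : ℝ) : ℝ) : ℂ) =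
      ((Real.pi * n / p : ℝ) : ℂ) * Complex.I := by
    rw [hpt]
    push_cast
    rw [natCast_eq_sqrt_sq_div_two p]
    generalize ((√(2 * p : ℝ) : ℝ) : ℂ) = a at *
    field_simp
    simp
  have hsin := sin_pi_mul_div_ne_zero hp hpn
  have hsinh : Complex.sinh (2 * Real.pi * centrePoint p k m 0 / (√(2 * p : ℝ) : ℝ)) ≠ 0 := by
    rw [hz, Complex.sinh_mul_I, ← Complex.ofReal_sin]
    exact mul_ne_zero (Complex.ofReal_ne_zero.mpr hsin) Complex.I_ne_zero
  have hval : continuousQDim p r s (centrePoint p k m 0) = genericValue p r s m := by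
    rw [← modeCoeff_div_eq_genericValue hp r s k m, ← hn, modeCoeff_div_modeCoeff, continuousQDim,
      hz]
    have e1 : ((Real.pi * n / p : ℝ) : ℂ) * Complex.I * (p * (r - 1)) =
        (n * (r - 1) : ℤ) * (Real.pi * Complex.I) := by
      push_cast; field_simp
    have e2 : ((Real.pi * n / p : ℝ) : ℂ) * Complex.I * s =
        ((Real.pi * n * s / p : ℝ) : ℂ) * Complex.I := by
      push_cast; ring
    rw [e1, e2, Complex.exp_int_mul, Complex.exp_pi_mul_I, Complex.sinh_mul_I, Complex.sinh_mul_I,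
      mul_div_assoc, mul_div_mul_right _ _ Complex.I_ne_zero, ← Complex.ofReal_sin,
      ← Complex.ofReal_sin, ← Complex.ofReal_div]
  have hcont : ContinuousAt (fun t : ℝ => continuousQDim p r s (centrePoint p k m t)) 0 := by
    have hc : Continuous fun t : ℝ => centrePoint p k m t := by
      simp_rw [hpt]
      fun_prop
    unfold continuousQDim
    refine ContinuousAt.div ?_ ?_ hsinh
    · exact Continuous.continuousAt (by fun_prop)
    · exact Continuous.continuousAt (by fun_prop)
  have := hcont.tendsto.mono_left (nhdsWithin_le_nhds (s := Set.Ioi 0))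
  rwa [hval] at this

/-! ### The line through a drip point -/

theorem centrePoint_mem_strip {p : ℕ} (hp : 0 < p) (k : ℤ) (m : ℕ) (t : ℝ) :
    centrePoint p k m t ∈ strip p k m := by
  have hp' : (0 : ℝ) < p := by exact_mod_cast hp
  have e : (centrePoint p k m t).im / √(2 * p : ℝ) = k + m / (2 * p) := by
    rw [centrePoint, div_div, ← pow_two, sqrt_two_mul_sq]
    field_simp
  rw [strip, Set.mem_ofPred_eq, e, add_lt_add_iff_left, add_lt_add_iff_left,
    div_lt_div_iff₀ (by positivity) (by positivity), div_lt_div_iff₀ (by positivity) (by positivity)]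
  constructor <;> nlinarith

/-- The index of the drip point is itself admissible and lies at distance zero, so the wall
condition on this line is just `Re ε < 0`. -/
theorem wall_centrePoint {p : ℕ} (k : ℤ) {m : ℕ} (hpm : ¬ p ∣ m) (t : ℝ) :
    wall p (centrePoint p k m t) = 0 := by
  have hpn : ¬ (p : ℤ) ∣ 2 * p * k + m := by
    rw [Int.dvd_add_right ⟨2 * k, by ring⟩, Int.natCast_dvd_natCast]
    exact hpm
  rw [wall, neg_eq_zero]
  refine IsLeast.csInf_eq ⟨⟨2 * p * k + m, hpn, ?_⟩, ?_⟩
  · simp [centrePoint]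
  · rintro x ⟨j, _, rfl⟩
    exact abs_nonneg _

theorem hasQDim_centrePoint_of_neg {p : ℕ} (hp : 0 < p) (r : ℤ) (s : ℕ) (k : ℤ) {m : ℕ}
    (hpm : ¬ p ∣ m) {t : ℝ} (ht : t < 0) :
    HasQDim p r s (centrePoint p k m t) (genericValue p r s m) :=
  hasQDim_generic hp r s hpm (centrePoint_mem_strip hp k m t) (by rwa [wall_centrePoint k hpm])

theorem HasQDim.qdim_eq {p : ℕ} {r : ℤ} {s : ℕ} {ε d : ℂ} (h : HasQDim p r s ε d) :
    qdim p r s ε = d := h.2.limUnder_eq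

end Singlet

theorem mainTheorem8 (p : ℕ) (hp : 2 ≤ p) (r : ℤ) (s : ℕ) (hs : 1 ≤ s) (hsp : s ≤ p)
    (k : ℤ) (m : ℕ) (hm : m < 2 * p) :
    -- strips with `m ≠ 0, p`
    (m ≠ 0 → m ≠ p → ∀ ε ∈ Singlet.strip p k m, ε.re < Singlet.wall p ε →
      Singlet.HasQDim p r s ε (Singlet.genericValue p r s m)) ∧
    -- strips with `m = 0` or `m = p`, off the centre line
    ((m = 0 ∨ m = p) → ∀ ε ∈ Singlet.strip p k m, ε.re < Singlet.wall p ε →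
      ε.im ≠ (2 * p * k + m) / √(2 * p) →
      Singlet.HasQDim p r s ε (Singlet.exceptionalValue p r s m)) ∧
    -- strips with `m = 0` or `m = p`, on the centre line
    ((m = 0 ∨ m = p) → ∀ ε ∈ Singlet.strip p k m, ε.re < Singlet.wall p ε →
      ε.im = (2 * p * k + m) / √(2 * p) →
      ∀ δ : ℝ, 0 < δ →
        Singlet.HasQDimAlong
          (𝓝[{y : ℝ | 0 < y ∧ δ ≤ |Real.sin (2 * Real.pi * ε.re / (√(2 * p) * y))|}] 0)
          p r s ε (Singlet.exceptionalValue p r s m)) ∧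
    -- agreement of the limits from both sides at the drip point, for `m ≠ 0, p`
    (m ≠ 0 → m ≠ p →
      (∀ t : ℝ, t ≠ 0 →
        Singlet.HasQDim p r s (Singlet.centrePoint p k m t)
          (Singlet.qdim p r s (Singlet.centrePoint p k m t))) ∧
      Tendsto (fun t : ℝ => Singlet.qdim p r s (Singlet.centrePoint p k m t)) (𝓝[>] 0)
        (𝓝 (Singlet.genericValue p r s m)) ∧
      Tendsto (fun t : ℝ => Singlet.qdim p r s (Singlet.centrePoint p k m t)) (𝓝[<] 0)
        (𝓝 (Singlet.genericValue p r s m))) := by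
  have hp0 : 0 < p := by omega
  have hdvd : m ≠ 0 → m ≠ p → ¬ p ∣ m := by
    rintro h0 h1 ⟨c, rfl⟩
    have hc : c < 2 := by nlinarith
    interval_cases c <;> simp at h0 h1
  refine ⟨fun h0 h1 ε hε hw => Singlet.hasQDim_generic hp0 r s (hdvd h0 h1) hε hw,
    fun h ε hε hw him => Singlet.hasQDim_exceptional hp r s h hε hw him,
    fun h ε _ hw him δ hδ => Singlet.hasQDimAlong_centre hp r s h hw him hδ,
    fun h0 h1 => ⟨fun t ht => ?_, ?_, ?_⟩⟩
  · rcases lt_or_gt_of_ne ht with h | h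
    · have := Singlet.hasQDim_centrePoint_of_neg hp0 r s k (hdvd h0 h1) h
      rwa [this.qdim_eq]
    · have := Singlet.hasQDim_continuous hp0 r s (ε := Singlet.centrePoint p k m t) h
      rwa [this.qdim_eq]
  · refine (Singlet.tendsto_continuousQDim hp0 r s k (hdvd h0 h1)).congr' ?_
    filter_upwards [self_mem_nhdsWithin] with t ht
    exact (Singlet.hasQDim_continuous hp0 r s (ε := Singlet.centrePoint p k m t) ht).qdim_eq.symm
  · refine tendsto_const_nhds.congr' ?_
    filter_upwards [self_mem_nhdsWithin] with t ht
    exact (Singlet.hasQDim_centrePoint_of_neg hp0 r s k (hdvd h0 h1) ht).qdim_eq.symm
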